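/- Let $G$ be a connected, simply connected nilpotent (real) Lie group and let $\mathcal I$ be a left-invariant complex structure on $G$, i.e. a left-invariant integrable almost complex structure ($\mathcal I$ commutes with the differentials of all left translations of $G$; right translations need not be holomorphic). Let $n=\dim_{\mathbb C}G=\tfrac12\dim_{\mathbb R}G$. Let $\Gamma\subset G$ be a discrete co-compact subgroup, and let $N=\Gamma\backslash G$ be the nilmanifold, equipped with the complex structure induced by $\mathcal I$. A *Salamon basis* is a family $\omega_1,\dots,\omega_n$ of left-invariant $(1,0)$-forms on $G$, linearly independent over $\mathbb C$ at every point, such that for suitable smooth complex-valued $1$-forms $\eta^i_j$ ($1\le j<i\le n$) on $G$ $$d\omega_i=\sum_{j<i}\eta^i_j\wedge\omega_j\qquad(1\le i\le n).$$ Then: 1. $G$ admits a left-invariant, nowhere vanishing, holomorphic section of the canonical bundle $\Lambda^{n,0}(G)$. 2. Salamon bases exist, and for every Salamon basis the form $\eta=\omega_1\wedge\dots\wedge\omega_n$ is such a section (left-invariant, nowhere vanishing, of type $(n,0)$, holomorphic), and moreover $d\eta=0$. 3. The canonical bundle $K(N)=\Lambda^{n,0}(N)$ is trivial as a holomorphic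 line bundle. -/

import Mathlib

open scoped Manifold ContDiff Topology

noncomputable section

namespace ComplexNilmanifold

section Forms

variable {E : Type*} [NormedAddCommGroup E] [NormedSpace ℝ E]

/-- The exterior product `α₀ ∧ ⋯ ∧ α_{k-1}` of complex-valued real covectors, normalised so that
`(α₀ ∧ ⋯ ∧ α_{k-1})(v₀, …, v_{k-1}) = det (α_i (v_j))`; for `k = 0` it is `1`. -/
def wedge {V : Type*} [AddCommGroup V] [Module ℝ V] [TopologicalSpace V] {k : ℕ}
    (α : Fin k → (V →L[ℝ] ℂ)) : V [⋀^Fin k]→L[ℝ] ℂ :=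
  ContinuousMultilinearMap.alternatization
    ((ContinuousMultilinearMap.mkPiAlgebra ℝ (Fin k) ℂ).compContinuousLinearMap α)

variable (E) in
/-- Complex-valued differential forms of degree `k` on a real manifold `M` modelled on `E`
(no regularity is imposed). -/
abbrev DForm (M : Type*) [TopologicalSpace M] [ChartedSpace E M] (k : ℕ) :=
  ∀ x : M, TangentSpace 𝓘(ℝ, E) x [⋀^Fin k]→L[ℝ] ℂ

variable (E) in
/-- Complex-valued `1`-forms, as fields of real-linear functionals. -/
abbrev OneForm (M : Type*) [TopologicalSpace M] [ChartedSpace E M] :=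
  ∀ x : M, TangentSpace 𝓘(ℝ, E) x →L[ℝ] ℂ

variable (E) in
/-- Fields of endomorphisms of the tangent bundle. -/
abbrev EndField (M : Type*) [TopologicalSpace M] [ChartedSpace E M] :=
  ∀ x : M, TangentSpace 𝓘(ℝ, E) x →L[ℝ] TangentSpace 𝓘(ℝ, E) x

variable {M : Type*} [TopologicalSpace M] [ChartedSpace E M] {k : ℕ}

/-- A `1`-form, regarded as a differential form of degree one. -/
def OneForm.toDForm (α : OneForm E M) : DForm E M 1 :=
  fun x => ContinuousAlternatingMap.ofSubsingleton ℝ (TangentSpace 𝓘(ℝ, E) x) ℂ (0 : Fin 1) (α x)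

/-- The coordinate expression of `θ` in the preferred chart at `x₀`: the pullback of `θ` under the
inverse of the chart. -/
def DForm.inChart (θ : DForm E M k) (x₀ : M) : E → E [⋀^Fin k]→L[ℝ] ℂ :=
  fun z => (θ ((extChartAt 𝓘(ℝ, E) x₀).symm z)).compContinuousLinearMap
    (mfderiv 𝓘(ℝ, E) 𝓘(ℝ, E) (extChartAt 𝓘(ℝ, E) x₀).symm z)

/-- Smoothness of a form on a set `U`: its coordinate expressions are smooth on the
corresponding sets. -/
def DForm.IsSmoothOn (θ : DForm E M k) (U : Set M) : Prop :=
  ∀ x₀ : M, ContDiffOn ℝ ∞ (θ.inChart x₀)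
    ((extChartAt 𝓘(ℝ, E) x₀).target ∩ (extChartAt 𝓘(ℝ, E) x₀).symm ⁻¹' U)

/-- The exterior derivative, computed at `x` in the preferred chart at `x`. -/
def DForm.d (θ : DForm E M k) : DForm E M (k + 1) :=
  fun x => (extDeriv (θ.inChart x) (extChartAt 𝓘(ℝ, E) x x)).compContinuousLinearMap
    (mfderiv 𝓘(ℝ, E) 𝓘(ℝ, E) (extChartAt 𝓘(ℝ, E) x) x)

/-- An (integrable almost) complex structure on a smooth manifold: a smooth field `J` of
endomorphisms of the tangent bundle with `J² = -1` and vanishing Nijenhuis tensor. -/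
structure IsComplexStructure [IsManifold 𝓘(ℝ, E) ∞ M] (J : EndField E M) : Prop where
  sq : ∀ (x : M) (v : TangentSpace 𝓘(ℝ, E) x), J x (J x v) = -v
  smooth : ∀ V : (∀ x : M, TangentSpace 𝓘(ℝ, E) x),
    ContMDiff 𝓘(ℝ, E) 𝓘(ℝ, E).tangent ∞ (fun x => (⟨x, V x⟩ : TangentBundle 𝓘(ℝ, E) M)) →
    ContMDiff 𝓘(ℝ, E) 𝓘(ℝ, E).tangent ∞
      (fun x => (⟨x, J x (V x)⟩ : TangentBundle 𝓘(ℝ, E) M))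
  integrable : ∀ V W : (∀ x : M, TangentSpace 𝓘(ℝ, E) x),
    ContMDiff 𝓘(ℝ, E) 𝓘(ℝ, E).tangent ∞ (fun x => (⟨x, V x⟩ : TangentBundle 𝓘(ℝ, E) M)) →
    ContMDiff 𝓘(ℝ, E) 𝓘(ℝ, E).tangent ∞ (fun x => (⟨x, W x⟩ : TangentBundle 𝓘(ℝ, E) M)) →
    ∀ x : M,
      VectorField.mlieBracket 𝓘(ℝ, E) (fun y => J y (V y)) (fun y => J y (W y)) x =
        VectorField.mlieBracket 𝓘(ℝ, E) V W x
          + J x (VectorField.mlieBracket 𝓘(ℝ, E) (fun y => J y (V y)) W x)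
          + J x (VectorField.mlieBracket 𝓘(ℝ, E) V (fun y => J y (W y)) x)

/-- The fibre `Λ^{p,0}_x` of the bundle of forms of type `(p,0)`: the alternating forms
that are complex multilinear with respect to `J`. -/
def typeP0 (J : EndField E M) (p : ℕ) (x : M) :
    Submodule ℂ (TangentSpace 𝓘(ℝ, E) x [⋀^Fin p]→L[ℝ] ℂ) where
  carrier := {α | ∀ (v : Fin p → TangentSpace 𝓘(ℝ, E) x) (i : Fin p),
    α (Function.update v i (J x (v i))) = Complex.I * α v}
  add_mem' := by
    intro a b ha hb v i
    simp only [ContinuousAlternatingMap.add_apply, ha v i, hb v i, mul_add]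
  zero_mem' := by
    intro v i
    simp
  smul_mem' := by
    intro c a ha v i
    simp only [ContinuousAlternatingMap.smul_apply, ha v i, smul_eq_mul]
    ring

/-- Holomorphic `p`-forms on an open set `U` of `(M, J)`, i.e. holomorphic sections of
`Λ^{p,0}` over `U`: smooth forms `θ` of type `(p,0)` with `∂̄θ = 0`. As `J` is integrable,
`dθ = ∂θ + ∂̄θ` with `∂θ` of type `(p+1,0)` and `∂̄θ` of type `(p,1)`, so that `∂̄θ = 0` means
that `dθ` is of type `(p+1,0)`. -/
structure DForm.IsHolomorphicOn {p : ℕ} (J : EndField E M) (θ : DForm E M p) (U : Set M) :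
    Prop where
  smooth : θ.IsSmoothOn U
  type : ∀ x ∈ U, θ x ∈ typeP0 J p x
  dbar : ∀ x ∈ U, θ.d x ∈ typeP0 J (p + 1) x

/-- Holomorphic functions on an open set `U` of `(M, J)`: smooth functions on `U` whose
differential is complex linear (the Cauchy-Riemann equations). -/
def IsHolomorphicFunOn (J : EndField E M) (f : M → ℂ) (U : Set M) : Prop :=
  ContMDiffOn 𝓘(ℝ, E) 𝓘(ℝ, ℂ) ∞ f U ∧
    ∀ x ∈ U, ∀ v : TangentSpace 𝓘(ℝ, E) x,
      NormedSpace.fromTangentSpace (𝕜 := ℝ) (f x)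
          (mfderiv 𝓘(ℝ, E) 𝓘(ℝ, ℂ) f x (J x v)) =
        Complex.I * NormedSpace.fromTangentSpace (𝕜 := ℝ) (f x)
          (mfderiv 𝓘(ℝ, E) 𝓘(ℝ, ℂ) f x v)

/-- The canonical bundle `K = Λ^{n,0}` of `(M, J)`, `n = dim_ℂ M`, is trivial as a holomorphic line
bundle: there is a fibrewise complex linear isomorphism `Φ` of the trivial line bundle `M × ℂ` onto
`K` which matches the holomorphic sections over every open set. -/
def CanonicalBundleHolomorphicallyTrivial (J : EndField E M) (n : ℕ) : Prop :=
  ∃ Φ : ∀ x : M, ℂ ≃ₗ[ℂ] typeP0 J n x,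
    ∀ (U : Set M), IsOpen U → ∀ f : M → ℂ,
      (IsHolomorphicFunOn J f U ↔
        DForm.IsHolomorphicOn J
          (fun x => (Φ x (f x) : TangentSpace 𝓘(ℝ, E) x [⋀^Fin n]→L[ℝ] ℂ)) U)

end Forms

section Group

variable {E : Type*} [NormedAddCommGroup E] [NormedSpace ℝ E]
  {G : Type*} [TopologicalSpace G] [ChartedSpace E G] [Group G]

/-- Left-invariance of a field of endomorphisms of the tangent bundle: it commutes with the
differentials of all left translations. -/
def IsLeftInvariantEnd (J : EndField E G) : Prop :=
  ∀ (g h : G) (v : TangentSpace 𝓘(ℝ, E) h),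
    J (g * h) (mfderiv 𝓘(ℝ, E) 𝓘(ℝ, E) (fun y : G => g * y) h v) =
      mfderiv 𝓘(ℝ, E) 𝓘(ℝ, E) (fun y : G => g * y) h (J h v)

/-- Left-invariance of a differential form: `L_g^* θ = θ` for all left translations `L_g`. -/
def DForm.IsLeftInvariant {k : ℕ} (θ : DForm E G k) : Prop :=
  ∀ g h : G, (θ (g * h)).compContinuousLinearMap
    (mfderiv 𝓘(ℝ, E) 𝓘(ℝ, E) (fun y : G => g * y) h) = θ h

/-- Salamon's basis: left-invariant `(1,0)`-forms `θ_1, …, θ_n`, linearly independent over `ℂ` at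
each point (hence a basis of the `(1,0)`-forms when `n = dim_ℂ G`), such that
`dθ_i = ∑_{j < i} η_j^i ∧ θ_j` for some smooth complex-valued `1`-forms `η_j^i`. -/
structure IsSalamonBasis {n : ℕ} (J : EndField E G) (θ : Fin n → OneForm E G) : Prop where
  leftInvariant : ∀ i, (θ i).toDForm.IsLeftInvariant
  type : ∀ i x, (θ i).toDForm x ∈ typeP0 J 1 x
  linearIndependent : ∀ x : G, LinearIndependent ℂ (fun i => θ i x)
  structureEquation : ∃ η : Fin n → Fin n → OneForm E G,
    (∀ i j, j < i → (η i j).toDForm.IsSmoothOn Set.univ) ∧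
    ∀ i x, (θ i).toDForm.d x = ∑ j ∈ Finset.Iio i, wedge ![η i j x, θ j x]

/-- The space `Γ \ G` of orbits of the left multiplication action of `Γ` on `G`, with the
quotient topology. -/
abbrev LeftQuotient (Γ : Subgroup G) : Type _ := MulAction.orbitRel.Quotient Γ G

/-- The projection `G → Γ \ G`. -/
def proj (Γ : Subgroup G) (g : G) : LeftQuotient Γ := Quotient.mk (MulAction.orbitRel Γ G) g

variable [FiniteDimensional ℝ E] [LieGroup 𝓘(ℝ, E) ∞ G] [T2Space G]

/-- The manifold structure on `Γ \ G` for a discrete subgroup `Γ`: its charts are the local inverses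
of the covering `G → Γ \ G` followed by charts of `G`. -/
instance leftQuotientChartedSpace (Γ : Subgroup G) [DiscreteTopology Γ] :
    ChartedSpace E (LeftQuotient Γ) :=
  haveI : IsTopologicalGroup G := topologicalGroup_of_lieGroup 𝓘(ℝ, E) ∞
  haveI : LocallyCompactSpace G := Manifold.locallyCompact_of_finiteDimensional 𝓘(ℝ, E)
  haveI : ProperlyDiscontinuousSMul Γ G := by
    exact Γ.properlyDiscontinuousSMul_of_tendsto_cofinite
      (Γ.tendsto_coe_cofinite_of_discrete (isDiscrete_iff_discreteTopology.mpr inferInstance))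
  MulAction.instChartedSpaceQuotient

/-- The almost complex structure on `Γ \ G` induced by the left-invariant `J` on `G`: at `y = Γ g` it
is `J_g` transported by the isomorphism `dπ_g`. (By left-invariance the choice of the representative
`g` of `y` does not matter.) -/
def inducedStructure (Γ : Subgroup G) [DiscreteTopology Γ] (J : EndField E G) :
    EndField E (LeftQuotient Γ) := fun y =>
  let g : G := Quotient.out y
  let dπ : TangentSpace 𝓘(ℝ, E) g →L[ℝ] TangentSpace 𝓘(ℝ, E) y :=
    mfderiv 𝓘(ℝ, E) 𝓘(ℝ, E) (proj Γ) g
  dπ ∘L J g ∘L dπ.inverse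

end Group

end ComplexNilmanifold

end

/-! Everything reduces to linear algebra on the Lie algebra, carried to the group by left
translation. In the complexified Lie algebra the vectors x + iJx form a complex subspace k =
g^{0,1}, and the vanishing of the Nijenhuis tensor says that k is a subalgebra. The (1,0)-forms are
the functionals that vanish on k, and for left-invariant forms dα(X, Y) = -α([X, Y]).

A triangular basis is built one functional at a time. Let α_1, …, α_r be found, with common kernel
h, a subalgebra containing k. If r < n then h ≠ k, and nilpotency gives h ≠ k + [h, h]
(`le_of_le_sup_map₂`). A functional that vanishes on k + [h, h] but not on h is the next one:
dα_{r+1} vanishes on h × h, hence lies in the ideal generated by α_1, …, α_r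
(`exists_eq_sum_of_vanish`). Nilpotency of the group passes to the Lie algebra through the
filtration W_{k+1} = {Y : Ad(g)Y - Y ∈ W_k for all g}. The differential at 1 of a map into the k-th
term of the upper central series lands in W_k, and the derivative of Ad is the bracket, so [g,
W_{k+1}] ⊆ W_k.

For any Salamon basis, the Leibniz rule writes dη as a sum of products in which ω_i is replaced by
dω_i. Each term of dω_i contains some ω_j with j < i, which is already a factor, so dη = 0
(`extDeriv_wedge_eq_zero`).

A closed nowhere vanishing form η of type (n,0) trivialises the canonical bundle: the fibres are
complex lines, and d(fη) = df ∧ η is of type (n+1,0) exactly when df is complex linear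
(`canonicalBundle_trivial_of_closed`). Being left-invariant, η descends to Γ \ G with the same chart
expressions, because in suitable charts the projection is a left translation. -/

noncomputable section

namespace ComplexNilmanifold

/-! ### Triangular functionals on a nilpotent algebra -/

section NilpotentAlgebra

variable {K L : Type*} [Field K] [AddCommGroup L] [Module K L] {br : L →ₗ[K] L →ₗ[K] L}
  {c : ℕ} {W : ℕ → Submodule K L}

/-- In a nilpotent algebra, a subalgebra that generates modulo commutators is everything. -/
theorem le_of_le_sup_map₂ (hanti : ∀ x y, br x y = -br y x)
    (hW0 : W 0 = ⊥) (hWc : W c = ⊤) (hW : ∀ k x, ∀ y ∈ W (k + 1), br x y ∈ W k)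
    {k h : Submodule K L} (hkh : k ≤ h) (hk : ∀ x ∈ k, ∀ y ∈ k, br x y ∈ k)
    (hh : ∀ x ∈ h, ∀ y ∈ h, br x y ∈ h) (hgen : h ≤ k ⊔ Submodule.map₂ br h h) : h ≤ k := by
  -- Descend along the filtration: modulo k, the algebra h lies in ever smaller W_j, and W_0 = 0
  -- ends the descent.
  have key : ∀ m, m ≤ c → h ≤ k ⊔ (h ⊓ W (c - m)) := by
    intro m
    induction m with
    | zero => intro _; simp [hWc]
    | succ m ih =>
      intro hm
      have ih := ih (by omega)
      have hc : c - m = (c - (m + 1)) + 1 := by omega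
      rw [hc] at ih
      refine hgen.trans (sup_le le_sup_left (Submodule.map₂_le.2 fun x hx y hy => ?_))
      obtain ⟨a, ha, u, hu, rfl⟩ := Submodule.mem_sup.1 (ih hx)
      obtain ⟨b, hb, v, hv, rfl⟩ := Submodule.mem_sup.1 (ih hy)
      -- Antisymmetry puts u into the second argument, the only one that the hypothesis on W
      -- controls.
      have e : br (a + u) (b + v) = br a b + (br (a + u) v - br b u) := by
        rw [hanti b u]; simp only [map_add, LinearMap.add_apply]; abel
      rw [e]
      exact Submodule.add_mem_sup (hk a ha b hb)
        ⟨sub_mem (hh _ hx _ hv.1) (hh _ (hkh hb) _ hu.1),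
          sub_mem (hW _ _ _ hv.2) (hW _ _ _ hu.2)⟩
  simpa [hW0] using key c le_rfl

/-- Functionals on a nilpotent algebra that vanish on a given subalgebra and are triangular with
respect to the bracket. -/
theorem exists_triangular_functionals [FiniteDimensional K L] (hanti : ∀ x y, br x y = -br y x)
    (hW0 : W 0 = ⊥) (hWc : W c = ⊤) (hW : ∀ k x, ∀ y ∈ W (k + 1), br x y ∈ W k)
    {k : Submodule K L} (hk : ∀ x ∈ k, ∀ y ∈ k, br x y ∈ k) (r : ℕ)
    (hr : r + Module.finrank K k ≤ Module.finrank K L) :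
    ∃ α : Fin r → Module.Dual K L, LinearIndependent K α ∧ (∀ i, ∀ x ∈ k, α i x = 0) ∧
      ∀ i x y, (∀ j < i, α j x = 0) → (∀ j < i, α j y = 0) → α i (br x y) = 0 := by
  induction r with
  | zero => exact ⟨Fin.elim0, linearIndependent_empty_type, fun i => i.elim0, fun i => i.elim0⟩
  | succ r ih =>
    obtain ⟨α, hli, hvan, htri⟩ := ih (by omega)
    let h : Submodule K L := (Submodule.span K (Set.range α)).dualCoannihilator
    have mem_h : ∀ x, x ∈ h ↔ ∀ i, α i x = 0 := by
      intro x
      simp only [h, Submodule.mem_dualCoannihilator]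
      refine ⟨fun H i => H _ (Submodule.subset_span ⟨i, rfl⟩), fun H φ hφ => ?_⟩
      induction hφ using Submodule.span_induction with
      | mem φ hφ => obtain ⟨i, rfl⟩ := hφ; exact H i
      | zero => rfl
      | add a b _ _ ha hb => simp [ha, hb]
      | smul a b _ hb => simp [hb]
    have hkh : k ≤ h := fun x hx => (mem_h x).2 fun i => hvan i x hx
    have hh : ∀ x ∈ h, ∀ y ∈ h, br x y ∈ h := fun x hx y hy => (mem_h _).2 fun i =>
      htri i x y (fun j _ => (mem_h x).1 hx j) (fun j _ => (mem_h y).1 hy j)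
    have hdim : r + Module.finrank K h = Module.finrank K L := by
      have := Subspace.finrank_add_finrank_dualCoannihilator_eq (Submodule.span K (Set.range α))
      rwa [finrank_span_eq_card hli, Fintype.card_fin] at this
    -- Otherwise h = k, while h has dimension dim L - r and k has dimension at most dim L - r - 1.
    have hne : ¬ h ≤ k ⊔ Submodule.map₂ br h h := by
      intro H
      have := Submodule.finrank_mono (le_of_le_sup_map₂ hanti hW0 hWc hW hkh hk hh H)
      omega
    obtain ⟨z, hz, hz'⟩ := SetLike.not_le_iff_exists.1 hne
    -- The next functional. It is independent of the α_i because they all vanish at z and f does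
    -- not; it kills [h, h], which is triangularity.
    obtain ⟨f, hfz, hf⟩ := Submodule.exists_le_ker_of_notMem hz'
    have hf' : ∀ x ∈ k ⊔ Submodule.map₂ br h h, f x = 0 := fun x hx => hf hx
    refine ⟨Fin.snoc α f, ?_, ?_, ?_⟩
    · rw [linearIndependent_finSnoc]
      refine ⟨hli, fun hmem => hfz ?_⟩
      exact (Submodule.mem_dualCoannihilator _).1 hz f hmem
    · intro i
      refine Fin.lastCases ?_ (fun i => ?_) i
      · intro x hx
        rw [Fin.snoc_last]; exact hf' x (Submodule.mem_sup_left hx)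
      · intro x hx
        rw [Fin.snoc_castSucc]; exact hvan i x hx
    · intro i
      refine Fin.lastCases ?_ (fun i => ?_) i
      · intro x y hx hy
        rw [Fin.snoc_last]
        refine hf' _ (Submodule.mem_sup_right (Submodule.apply_mem_map₂ _ ?_ ?_))
        · exact (mem_h x).2 fun j => by simpa using hx j.castSucc (Fin.castSucc_lt_last j)
        · exact (mem_h y).2 fun j => by simpa using hy j.castSucc (Fin.castSucc_lt_last j)
      · intro x y hx hy
        rw [Fin.snoc_castSucc]
        refine htri i x y (fun j hj => ?_) (fun j hj => ?_)
        · simpa using hx j.castSucc (by simpa using hj)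
        · simpa using hy j.castSucc (by simpa using hj)

/-- Finitely many independent functions are independent on finitely many points. -/
theorem exists_det_ne_zero {K X ι : Type*} [Field K] [Fintype ι] [DecidableEq ι] {α : ι → X → K}
    (hα : LinearIndependent K α) : ∃ x : ι → X, (Matrix.of fun i j => α i (x j)).det ≠ 0 := by
  -- A functional vanishing on all the columns (α_i(x))_i would be a linear relation between the
  -- α_i.
  have htop : Submodule.span K (Set.range fun x i => α i x) = ⊤ := by
    by_contra hne
    obtain ⟨f, hf0, hf⟩ := Submodule.exists_le_ker_of_lt_top _ (lt_top_iff_ne_top.2 hne)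
    refine hf0 (LinearMap.pi_ext' fun i => LinearMap.ext_ring ?_)
    have h0 : ∑ i, f (Pi.single i 1) • α i = 0 := by
      ext x
      have hx : f (fun i => α i x) = 0 := hf (Submodule.subset_span ⟨x, rfl⟩)
      rw [LinearMap.pi_apply_eq_sum_univ] at hx
      have hs : ∀ i : ι, (fun j => if i = j then (1 : K) else 0) = Pi.single i 1 := fun i => by
        ext j; simp [Pi.single_apply, eq_comm]
      simpa [mul_comm, hs] using hx
    simpa using Fintype.linearIndependent_iff.1 hα _ h0 i
  obtain ⟨f, hfs, -, hli⟩ :=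
    Submodule.exists_fun_fin_finrank_span_eq K (Set.range fun x i => α i x)
  have hcard : Module.finrank K (Submodule.span K (Set.range fun x i => α i x)) =
      Fintype.card ι := by rw [htop]; simp
  let e : ι ≃ Fin (Module.finrank K (Submodule.span K (Set.range fun x i => α i x))) :=
    (Fintype.equivFin ι).trans (finCongr hcard.symm)
  choose x hx using fun j => hfs (e j)
  refine ⟨x, ?_⟩
  have hcol : LinearIndependent K (Matrix.of fun i j => α i (x j)).col := by
    have : (Matrix.of fun i j => α i (x j)).col = f ∘ e := by
      ext j i; exact congrFun (hx j) i
    rw [this]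
    exact hli.comp _ e.injective
  exact ((Matrix.isUnit_iff_isUnit_det _).1
    (Matrix.linearIndependent_cols_iff_isUnit.1 hcol)).ne_zero

/-- Independent functionals admit a dual family of vectors. -/
theorem exists_dual_vectors {K L ι : Type*} [Field K] [AddCommGroup L] [Module K L] [Fintype ι]
    [DecidableEq ι] {α : ι → Module.Dual K L} (hα : LinearIndependent K α) :
    ∃ e : ι → L, ∀ i j, α i (e j) = if i = j then 1 else 0 := by
  have hα' : LinearIndependent K fun i => (α i : L → K) := by
    rw [Fintype.linearIndependent_iff] at hα ⊢
    refine fun g hg => hα g (LinearMap.ext fun x => ?_)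
    simpa using congrFun hg x
  obtain ⟨x, hx⟩ := exists_det_ne_zero hα'
  let A := Matrix.of fun i j => α i (x j)
  refine ⟨fun j => ∑ k, A⁻¹ k j • x k, fun i j => ?_⟩
  have : (A * A⁻¹) i j = (1 : Matrix ι ι K) i j := by
    rw [Matrix.mul_nonsing_inv _ (isUnit_iff_ne_zero.2 hx)]
  rw [Matrix.one_apply, Matrix.mul_apply] at this
  simpa [A, mul_comm] using this

/-- An alternating bilinear form that vanishes on the common kernel of independent functionals
lies in the ideal that they generate. -/
theorem exists_eq_sum_of_vanish [CharZero K] {ι : Type*} [Fintype ι] [DecidableEq ι]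
    {α : ι → Module.Dual K L} (hα : LinearIndependent K α) (s : Finset ι)
    (β : L →ₗ[K] L →ₗ[K] K) (hβ : ∀ x y, β x y = -β y x)
    (hvan : ∀ x y, (∀ j ∈ s, α j x = 0) → (∀ j ∈ s, α j y = 0) → β x y = 0) :
    ∃ η : ι → Module.Dual K L, ∀ x y, β x y = ∑ j ∈ s, (η j x * α j y - η j y * α j x) := by
  obtain ⟨e, he⟩ := exists_dual_vectors hα
  -- Projection onto the span of the e_j, j ∈ s, along the common kernel of the α_j, so β vanishes
  -- on pairs (x - qx, y - qy).
  let q : L →ₗ[K] L := ∑ j ∈ s, (α j).smulRight (e j)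
  have hq : ∀ x, q x = ∑ j ∈ s, α j x • e j := fun x => by simp [q]
  have hP : ∀ x, ∀ i ∈ s, α i (x - q x) = 0 := by
    intro x i hi
    simp [hq, he, hi]
  -- Expanding β(x - qx, y - qy) = 0 gives β(x, y) = β(x, qy) + β(qx, y) - β(qx, qy).
  -- Antisymmetrising would produce the last term twice, hence the factor 1/2.
  refine ⟨fun j => β.flip (e j) - (2⁻¹ : K) • (β.flip (e j) ∘ₗ q), fun x y => ?_⟩
  have h0 := hvan _ _ (hP x) (hP y)
  have e1 : ∀ x y, ∑ j ∈ s, β x (e j) * α j y = β x (q y) := by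
    intro x y
    simp [hq, mul_comm]
  have e2 : ∑ j ∈ s, ((β.flip (e j) - (2⁻¹ : K) • (β.flip (e j) ∘ₗ q)) x * α j y -
      (β.flip (e j) - (2⁻¹ : K) • (β.flip (e j) ∘ₗ q)) y * α j x) =
      β x (q y) - 2⁻¹ * β (q x) (q y) - (β y (q x) - 2⁻¹ * β (q y) (q x)) := by
    rw [← e1 x y, ← e1 (q x) y, ← e1 y x, ← e1 (q y) x, Finset.mul_sum, Finset.mul_sum,
      ← Finset.sum_sub_distrib, ← Finset.sum_sub_distrib, ← Finset.sum_sub_distrib]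
    refine Finset.sum_congr rfl fun j _ => ?_
    simp only [LinearMap.sub_apply, LinearMap.flip_apply, LinearMap.smul_apply,
      LinearMap.comp_apply, smul_eq_mul]
    ring
  rw [e2, hβ y (q x), hβ (q y) (q x)]
  simp only [map_sub, LinearMap.sub_apply] at h0
  have h2 : (2 : K) * 2⁻¹ = 1 := mul_inv_cancel₀ two_ne_zero
  linear_combination h0 + (-β (q x) (q y)) * h2

end NilpotentAlgebra

/-! ### Integrability in the complexified Lie algebra -/

section Complexification

open scoped TensorProduct

variable {V : Type*} [AddCommGroup V] [Module ℝ V]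

/-- The algebraic form of Salamon's theorem: triangular bases of the `(1,0)`-forms on a nilpotent
Lie algebra with a complex structure. -/
theorem exists_triangular_one_zero_forms [FiniteDimensional ℝ V] {n c : ℕ}
    (hn : Module.finrank ℝ V = 2 * n) (br : V →ₗ[ℝ] V →ₗ[ℝ] V) (hanti : ∀ x y, br x y = -br y x)
    {W : ℕ → Submodule ℝ V}
    (hW0 : W 0 = ⊥) (hWc : W c = ⊤) (hW : ∀ k x, ∀ y ∈ W (k + 1), br x y ∈ W k)
    (J : V →ₗ[ℝ] V) (hJ : ∀ x, J (J x) = -x)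
    (hint : ∀ x y, br (J x) (J y) = br x y + J (br (J x) y) + J (br x (J y))) :
    ∃ θ : Fin n → V →ₗ[ℝ] ℂ, LinearIndependent ℂ θ ∧ (∀ i x, θ i (J x) = Complex.I * θ i x) ∧
      ∃ η : Fin n → Fin n → V →ₗ[ℝ] ℂ, ∀ i x y,
        -θ i (br x y) = ∑ j ∈ Finset.Iio i, (η i j x * θ j y - η i j y * θ j x) := by
  let brC : ℂ ⊗[ℝ] V →ₗ[ℂ] ℂ ⊗[ℝ] V →ₗ[ℂ] ℂ ⊗[ℝ] V := LinearMap.BilinMap.baseChange ℂ br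
  have brC_tmul : ∀ (a b : ℂ) (x y : V), brC (a ⊗ₜ x) (b ⊗ₜ y) = (b * a) ⊗ₜ[ℝ] br x y := by
    intro a b x y
    simp [brC, mul_comm]
  have hantiC : ∀ x y, brC x y = -brC y x := by
    intro x y
    induction x with
    | zero => simp
    | add a b ha hb => simp [ha, hb, add_comm]
    | tmul a x =>
      induction y with
      | zero => simp
      | add a b ha hb => simp [ha, hb, add_comm]
      | tmul b y => rw [brC_tmul, brC_tmul, hanti x y, TensorProduct.tmul_neg, mul_comm]
  have hWC : ∀ k x, ∀ y ∈ (W (k + 1)).baseChange ℂ, brC x y ∈ (W k).baseChange ℂ := by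
    intro k x y hy
    rw [Submodule.baseChange_eq_span] at hy
    induction hy using Submodule.span_induction with
    | mem y hy =>
      obtain ⟨y, hy, rfl⟩ := hy
      induction x with
      | zero => simp
      | add a b ha hb => simpa using add_mem ha hb
      | tmul a x =>
        change brC (a ⊗ₜ x) (1 ⊗ₜ y) ∈ _
        rw [brC_tmul]
        exact Submodule.tmul_mem_baseChange_of_mem _ (hW k x y hy)
    | zero => simp
    | add a b _ _ ha hb => simpa using add_mem ha hb
    | smul a b _ hb => simpa using Submodule.smul_mem _ a hb
  -- x ↦ x + iJx, whose range is the -i eigenspace of the complexified J, the space of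
  -- (0,1)-vectors.
  let κ : V →ₗ[ℝ] ℂ ⊗[ℝ] V :=
    TensorProduct.mk ℝ ℂ V 1 + (TensorProduct.mk ℝ ℂ V Complex.I) ∘ₗ J
  have hκ : ∀ x, κ x = 1 ⊗ₜ x + Complex.I ⊗ₜ J x := fun x => rfl
  have hIκ : ∀ x, Complex.I • κ x = κ (-J x) := by
    intro x
    simp [hκ, hJ, TensorProduct.smul_tmul', TensorProduct.neg_tmul, TensorProduct.tmul_neg,
      add_comm]
  let k : Submodule ℂ (ℂ ⊗[ℝ] V) :=
    { LinearMap.range κ with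
      smul_mem' := by
        rintro a _ ⟨x, rfl⟩
        refine ⟨a.re • x + a.im • (-J x), ?_⟩
        rw [map_add, map_smul, map_smul, ← hIκ]
        conv_rhs => rw [← Complex.re_add_im a, add_smul, mul_smul]
        rfl }
  have hk : ∀ x ∈ k, ∀ y ∈ k, brC x y ∈ k := by
    rintro _ ⟨x, rfl⟩ _ ⟨y, rfl⟩
    refine ⟨br x y - br (J x) (J y), ?_⟩
    -- The Nijenhuis identity with J applied: it makes [κx, κy] equal to κ([x, y] - [Jx, Jy]).
    have e : J (br x y - br (J x) (J y)) = br (J x) y + br x (J y) := by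
      rw [hint]
      simp only [map_sub, map_add, hJ]
      abel
    simp only [hκ, e, map_add, LinearMap.add_apply, brC_tmul]
    simp only [mul_one, one_mul, Complex.I_mul_I, TensorProduct.tmul_add, TensorProduct.tmul_sub,
      TensorProduct.neg_tmul]
    abel
  -- An upper bound suffices: it leaves room for n functionals vanishing on k.
  have hdimk : Module.finrank ℂ k ≤ n := by
    have h1 : Module.finrank ℝ k ≤ Module.finrank ℝ V := by
      have e : Module.finrank ℝ k = Module.finrank ℝ (LinearMap.range κ) := rfl
      rw [e]
      exact LinearMap.finrank_range_le κ
    have h2 := Module.finrank_mul_finrank ℝ ℂ k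
    rw [Complex.finrank_real_complex] at h2
    omega
  obtain ⟨α, hα, hαk, htri⟩ := exists_triangular_functionals (br := brC) (c := c)
    (W := fun j => (W j).baseChange ℂ) hantiC (by simp [hW0]) (by simp [hWc]) hWC hk n
    (by rw [Module.finrank_baseChange]; omega)
  refine ⟨fun i => (α i).restrictScalars ℝ ∘ₗ TensorProduct.mk ℝ ℂ V 1, ?_, ?_, ?_⟩
  · rw [Fintype.linearIndependent_iff] at hα ⊢
    refine fun g hg => hα g ?_
    refine TensorProduct.AlgebraTensorModule.curry_injective (LinearMap.ext_ring ?_)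
    ext x
    simpa using LinearMap.congr_fun hg x
  · intro i x
    -- κ(Jx) = Jx - ix, so vanishing on it says α(Jx) = iα(x).
    have h1 := hαk i (κ (J x)) ⟨_, rfl⟩
    have h2 : (Complex.I ⊗ₜ[ℝ] x : ℂ ⊗[ℝ] V) = Complex.I • (1 ⊗ₜ x) := by
      simp [TensorProduct.smul_tmul']
    rw [hκ, hJ, map_add, TensorProduct.tmul_neg, map_neg, h2, map_smul] at h1
    simpa [← sub_eq_add_neg, sub_eq_zero] using h1
  · choose η hη using fun i => exists_eq_sum_of_vanish hα (Finset.Iio i) (-(brC.compr₂ (α i)))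
      (fun x y => by simp [hantiC x y])
      (fun x y hx hy => by
        simp [htri i x y (fun j hj => hx j (by simpa using hj)) fun j hj => hy j (by simpa using hj)])
    refine ⟨fun i j => (η i j).restrictScalars ℝ ∘ₗ TensorProduct.mk ℝ ℂ V 1, fun i x y => ?_⟩
    simpa [brC_tmul] using hη i (1 ⊗ₜ x) (1 ⊗ₜ y)

end Complexification

/-! ### Exterior products as determinants -/

section WedgeAlgebra

variable {V : Type*} [AddCommGroup V] [Module ℝ V] [TopologicalSpace V] {n : ℕ}

theorem wedge_apply (α : Fin n → V →L[ℝ] ℂ) (v : Fin n → V) :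
    wedge α v = (Matrix.of fun i j => α i (v j)).det := by
  rw [wedge, ContinuousMultilinearMap.alternatization_apply_apply, ← Matrix.det_transpose,
    Matrix.det_apply]
  simp

theorem wedge_pair_apply (β γ : V →L[ℝ] ℂ) (x y : V) :
    wedge ![β, γ] ![x, y] = β x * γ y - β y * γ x := by
  simp [wedge_apply, Matrix.det_fin_two]

theorem wedge_compContinuousLinearMap {V' : Type*} [AddCommGroup V'] [Module ℝ V']
    [TopologicalSpace V'] (α : Fin n → V →L[ℝ] ℂ) (f : V' →L[ℝ] V) :
    (wedge α).compContinuousLinearMap f = wedge fun i => (α i).comp f := by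
  ext v
  simp [wedge_apply]

/-- Laplace expansion along the row of β. The alternating sum over omitted vectors has the same
shape as the exterior derivative. -/
theorem wedge_cons_apply (β : V →L[ℝ] ℂ) (α : Fin n → V →L[ℝ] ℂ) (v : Fin (n + 1) → V) :
    wedge (Fin.cons β α : Fin (n + 1) → V →L[ℝ] ℂ) v =
      ∑ k : Fin (n + 1), (-1) ^ (k : ℕ) * (β (v k) * wedge α (k.removeNth v)) := by
  rw [wedge_apply, Matrix.det_succ_row_zero]
  refine Finset.sum_congr rfl fun k _ => ?_
  rw [wedge_apply, mul_assoc]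
  rfl

theorem matrix_of_update (α : Fin n → V →L[ℝ] ℂ) (i : Fin n) (β : V →L[ℝ] ℂ) (v : Fin n → V) :
    (Matrix.of fun k j => Function.update α i β k (v j)) =
      (Matrix.of fun k j => α k (v j)).updateRow i fun j => β (v j) := by
  ext k j
  by_cases h : k = i
  · subst h; simp
  · simp [h]

theorem wedge_update_add (α : Fin n → V →L[ℝ] ℂ) (i : Fin n) (β γ : V →L[ℝ] ℂ) :
    wedge (Function.update α i (β + γ)) =
      wedge (Function.update α i β) + wedge (Function.update α i γ) := by
  ext v
  simp only [ContinuousAlternatingMap.add_apply, wedge_apply, matrix_of_update]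
  exact Matrix.det_updateRow_add _ _ _ _

theorem wedge_update_smul (α : Fin n → V →L[ℝ] ℂ) (i : Fin n) (c : ℂ) (β : V →L[ℝ] ℂ) :
    wedge (Function.update α i (c • β)) = c • wedge (Function.update α i β) := by
  ext v
  simp only [ContinuousAlternatingMap.smul_apply, wedge_apply, matrix_of_update, smul_eq_mul]
  exact Matrix.det_updateRow_smul _ _ _ _

/-- The exterior product as a function of one of its factors. -/
def wedgeUpdate (α : Fin n → V →L[ℝ] ℂ) (i : Fin n) :
    (V →L[ℝ] ℂ) →ₗ[ℂ] V [⋀^Fin n]→L[ℝ] ℂ where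
  toFun β := wedge (Function.update α i β)
  map_add' := wedge_update_add α i
  map_smul' := wedge_update_smul α i

theorem wedgeUpdate_apply (α : Fin n → V →L[ℝ] ℂ) (i : Fin n) (β : V →L[ℝ] ℂ) :
    wedgeUpdate α i β = wedge (Function.update α i β) := rfl

theorem wedge_update_real_smul (α : Fin n → V →L[ℝ] ℂ) (i : Fin n) (c : ℝ) (β : V →L[ℝ] ℂ) :
    wedge (Function.update α i (c • β)) = c • wedge (Function.update α i β) := by
  have := wedge_update_smul α i (c : ℂ) β
  rw [← Complex.coe_smul c β, this]
  ext v
  simp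

theorem wedge_eq_zero_of_eq (α : Fin n → V →L[ℝ] ℂ) {i j : Fin n} (hij : i ≠ j)
    (h : α i = α j) : wedge α = 0 := by
  ext v
  rw [wedge_apply, Matrix.det_zero_of_row_eq hij]
  · rfl
  · ext k; simp [h]

theorem wedge_comp_swap (α : Fin n → V →L[ℝ] ℂ) {i j : Fin n} (hij : i ≠ j) :
    wedge (α ∘ Equiv.swap i j) = -wedge α := by
  ext v
  have := Matrix.det_permute (Equiv.swap i j) (Matrix.of fun i j => α i (v j))
  rw [Equiv.Perm.sign_swap hij] at this
  rw [ContinuousAlternatingMap.neg_apply, wedge_apply, wedge_apply]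
  simpa [Matrix.submatrix, Function.comp_def] using this

theorem wedge_ne_zero_of_linearIndependent {α : Fin n → V →L[ℝ] ℂ} (hα : LinearIndependent ℂ α) :
    wedge α ≠ 0 := by
  have hα' : LinearIndependent ℂ fun i => (α i : V → ℂ) := by
    rw [Fintype.linearIndependent_iff] at hα ⊢
    refine fun g hg => hα g (ContinuousLinearMap.ext fun x => ?_)
    simpa using congrFun hg x
  obtain ⟨v, hv⟩ := exists_det_ne_zero hα'
  intro h
  rw [← wedge_apply, h] at hv
  exact hv rfl

/-- Applying J to the j-th vector multiplies the j-th column of the determinant by i. -/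
theorem wedge_update_of_one_zero {α : Fin n → V →L[ℝ] ℂ} {J : V → V}
    (hα : ∀ i v, α i (J v) = Complex.I * α i v) (v : Fin n → V) (j : Fin n) :
    wedge α (Function.update v j (J (v j))) = Complex.I * wedge α v := by
  rw [wedge_apply, wedge_apply]
  have e : (Matrix.of fun i k => α i (Function.update v j (J (v j)) k)) =
      (Matrix.of fun i k => α i (v k)).updateCol j (Complex.I • fun i => α i (v j)) := by
    ext i k
    by_cases h : k = j
    · subst h; simp [hα]
    · simp [h]
  have e' : (Matrix.of fun i k => α i (v k)).updateCol j (fun i => α i (v j)) =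
      Matrix.of fun i k => α i (v k) := by
    ext i k
    by_cases h : k = j
    · subst h; simp
    · simp [h]
  rw [e, Matrix.det_updateCol_smul, e']

end WedgeAlgebra

/-! ### Exterior derivative of an exterior product -/

section WedgeCalculus

variable {E : Type*} [NormedAddCommGroup E] [NormedSpace ℝ E] {n : ℕ}

variable (E n) in
/-- The exterior product of covectors as a continuous multilinear map. -/
def wedgeMultilinear :
    ContinuousMultilinearMap ℝ (fun _ : Fin n => E →L[ℝ] ℂ) (E [⋀^Fin n]→L[ℝ] ℂ) :=
  MultilinearMap.mkContinuous
    { toFun := wedge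
      map_update_add' := by
        intro inst α i β γ
        rw [Subsingleton.elim inst (instDecidableEqFin n)]
        exact wedge_update_add α i β γ
      map_update_smul' := by
        intro inst α i c β
        rw [Subsingleton.elim inst (instDecidableEqFin n)]
        exact wedge_update_real_smul α i c β }
    -- The Leibniz expansion of the determinant has n! terms, each bounded by the product of the
    -- norms.
    (n.factorial : ℝ) fun α => by
      refine ContinuousAlternatingMap.opNorm_le_bound _ (by positivity) fun v => ?_
      change ‖wedge α v‖ ≤ _
      rw [wedge_apply, ← Matrix.det_transpose, Matrix.det_apply]
      refine (norm_sum_le _ _).trans ?_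
      have : ∀ σ ∈ (Finset.univ : Finset (Equiv.Perm (Fin n))),
          ‖Equiv.Perm.sign σ • ∏ i, (Matrix.of fun i j => α i (v j)).transpose (σ i) i‖ ≤
            (∏ i, ‖α i‖) * ∏ i, ‖v i‖ := by
        intro σ _
        rw [Units.smul_def, zsmul_eq_mul, norm_mul, norm_prod]
        have h1 : ‖((Equiv.Perm.sign σ : ℤ) : ℂ)‖ = 1 := by
          rcases Int.units_eq_one_or (Equiv.Perm.sign σ) with h | h <;> simp [h]
        rw [h1, one_mul, ← Equiv.prod_comp σ fun i => ‖v i‖, ← Finset.prod_mul_distrib]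
        exact Finset.prod_le_prod (fun _ _ => norm_nonneg _) fun i _ => (α i).le_opNorm _
      refine (Finset.sum_le_card_nsmul _ _ _ this).trans ?_
      rw [Finset.card_univ, Fintype.card_perm, Fintype.card_fin, nsmul_eq_mul, mul_assoc]

theorem wedgeMultilinear_apply (α : Fin n → E →L[ℝ] ℂ) : wedgeMultilinear E n α = wedge α := rfl

theorem contDiffOn_wedge {F : Type*} [NormedAddCommGroup F] [NormedSpace ℝ F] {s : Set F}
    {A : Fin n → F → E →L[ℝ] ℂ} (hA : ∀ i, ContDiffOn ℝ ∞ (A i) s) :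
    ContDiffOn ℝ ∞ (fun z => wedge fun i => A i z) s :=
  (wedgeMultilinear E n).contDiff.comp_contDiffOn (contDiffOn_pi.2 hA)

theorem hasFDerivAt_wedge {A : Fin n → E → E →L[ℝ] ℂ} {z : E}
    (hA : ∀ i, DifferentiableAt ℝ (A i) z) :
    HasFDerivAt (fun z => wedge fun i => A i z)
      (((wedgeMultilinear E n).linearDeriv fun i => A i z).comp
        (ContinuousLinearMap.pi fun i => fderiv ℝ (A i) z)) z :=
  ((wedgeMultilinear E n).hasFDerivAt _).comp z
    (hasFDerivAt_pi.2 fun i => (hA i).hasFDerivAt)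

/-- The Leibniz rule before antisymmetrisation: the full derivative of A_i, not only its alternating
part, stands in the i-th slot. -/
theorem extDeriv_wedge_apply {A : Fin n → E → E →L[ℝ] ℂ} {z : E}
    (hA : ∀ i, DifferentiableAt ℝ (A i) z) (v : Fin (n + 1) → E) :
    extDeriv (fun z => wedge fun i => A i z) z v =
      ∑ i : Fin n, ∑ k : Fin (n + 1), (-1) ^ (k : ℕ) *
        wedge (Function.update (fun i => A i z) i (fderiv ℝ (A i) z (v k))) (k.removeNth v) := by
  rw [extDeriv, ContinuousAlternatingMap.alternatizeUncurryFin_apply,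
    (hasFDerivAt_wedge hA).fderiv, Finset.sum_comm]
  refine Finset.sum_congr rfl fun k _ => ?_
  rw [ContinuousLinearMap.comp_apply, ContinuousMultilinearMap.linearDeriv_apply,
    ContinuousAlternatingMap.sum_apply, zsmul_eq_mul, Finset.mul_sum]
  refine Finset.sum_congr rfl fun i _ => ?_
  simp [wedgeMultilinear_apply]

/-- Inserting a symmetric bilinear form into an exterior product gives zero. -/
theorem sum_wedge_update_eq_zero_of_symm [FiniteDimensional ℝ E] (α : Fin n → E →L[ℝ] ℂ)
    (i : Fin n) (b : E →L[ℝ] E →L[ℝ] ℂ) (hb : ∀ x y, b x y = b y x) (v : Fin (n + 1) → E) :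
    ∑ k : Fin (n + 1), (-1) ^ (k : ℕ) * wedge (Function.update α i (b (v k))) (k.removeNth v) = 0 := by
  let e := Module.finBasis ℝ E
  let f : Fin (Module.finrank ℝ E) → E →L[ℝ] ℂ := fun m =>
    Complex.ofRealCLM.comp (LinearMap.toContinuousLinearMap (e.coord m))
  have hsum : ∀ (g : E →L[ℝ] ℂ), g = ∑ l, g (e l) • f l := by
    intro g
    ext x
    conv_lhs => rw [← e.sum_repr x]
    simp only [map_sum, map_smul]
    simp [f, mul_comm]
  have hw : ∀ (c : Fin (Module.finrank ℝ E) → ℂ) (g : Fin (Module.finrank ℝ E) → E →L[ℝ] ℂ)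
      (u : Fin n → E), wedge (Function.update α i (∑ l, c l • g l)) u =
        ∑ l, c l * wedge (Function.update α i (g l)) u := by
    intro c g u
    change wedgeUpdate α i _ u = ∑ l, c l * wedgeUpdate α i _ u
    simp
  have hbv : ∀ x, b x = ∑ m, f m x • b (e m) := by
    intro x
    ext y
    rw [hb, hsum (b y)]
    simp [hb y, mul_comm]
  -- With b written as the sum of b(e_m, e_l) f_m ⊗ f_l, the sum in question becomes that of b(e_m,
  -- e_l) D_{ml}. Exchanging f_m and f_l changes the sign of D_{ml}, while b is symmetric.
  let D : Fin (Module.finrank ℝ E) → Fin (Module.finrank ℝ E) → ℂ := fun m l =>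
    wedge (Fin.cons (f m) (Function.update α i (f l)) : Fin (n + 1) → E →L[ℝ] ℂ) v
  have hD : ∀ m l, D m l = -D l m := by
    intro m l
    have : (Fin.cons (f m) (Function.update α i (f l)) : Fin (n + 1) → E →L[ℝ] ℂ) =
        (Fin.cons (f l) (Function.update α i (f m)) : Fin (n + 1) → E →L[ℝ] ℂ) ∘
          Equiv.swap 0 i.succ := by
      ext k x
      refine Fin.cases ?_ (fun k => ?_) k
      · simp
      · by_cases h : k = i
        · subst h
          rw [Function.comp_apply, Equiv.swap_apply_right, Fin.cons_succ, Fin.cons_zero,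
            Function.update_self]
        · rw [Function.comp_apply, Equiv.swap_apply_of_ne_of_ne (Fin.succ_ne_zero k) (by simpa)]
          rw [Fin.cons_succ, Fin.cons_succ, Function.update_of_ne h, Function.update_of_ne h]
    simp only [D]
    rw [this, wedge_comp_swap _ (Fin.succ_ne_zero i).symm]
    rfl
  have key : ∑ k : Fin (n + 1), (-1) ^ (k : ℕ) * wedge (Function.update α i (b (v k))) (k.removeNth v) =
      ∑ m, ∑ l, b (e m) (e l) * D m l := by
    have h1 : ∀ k : Fin (n + 1), (-1) ^ (k : ℕ) *
        wedge (Function.update α i (b (v k))) (k.removeNth v) =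
        ∑ m, ∑ l, b (e m) (e l) * ((-1) ^ (k : ℕ) *
          (f m (v k) * wedge (Function.update α i (f l)) (k.removeNth v))) := by
      intro k
      rw [hbv (v k), hw, Finset.mul_sum]
      refine Finset.sum_congr rfl fun m _ => ?_
      conv_lhs => rw [hsum (b (e m)), hw, Finset.mul_sum, Finset.mul_sum]
      exact Finset.sum_congr rfl fun l _ => by ring
    rw [Finset.sum_congr rfl fun k _ => h1 k, Finset.sum_comm]
    refine Finset.sum_congr rfl fun m _ => ?_
    rw [Finset.sum_comm]
    refine Finset.sum_congr rfl fun l _ => ?_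
    rw [← Finset.mul_sum, ← wedge_cons_apply]
  have hanti : ∑ m, ∑ l, b (e m) (e l) * D m l = -∑ m, ∑ l, b (e m) (e l) * D m l := by
    conv_lhs => rw [Finset.sum_comm]
    rw [← Finset.sum_neg_distrib]
    refine Finset.sum_congr rfl fun m _ => ?_
    rw [← Finset.sum_neg_distrib]
    refine Finset.sum_congr rfl fun l _ => ?_
    rw [hb, hD l m]; ring
  rw [key]
  exact self_eq_neg.1 hanti

/-- An exterior product of `1`-forms whose derivatives are triangular is closed. -/
theorem extDeriv_wedge_eq_zero [FiniteDimensional ℝ E] {A : Fin n → E → E →L[ℝ] ℂ} {z : E}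
    (hA : ∀ i, DifferentiableAt ℝ (A i) z) (η : Fin n → Fin n → E →L[ℝ] ℂ)
    (hη : ∀ i x y, fderiv ℝ (A i) z x y - fderiv ℝ (A i) z y x =
      ∑ j ∈ Finset.Iio i, (η i j x * A j z y - η i j y * A j z x)) :
    extDeriv (fun z => wedge fun i => A i z) z = 0 := by
  ext v
  rw [extDeriv_wedge_apply hA]
  change _ = (0 : ℂ)
  refine Finset.sum_eq_zero fun i _ => ?_
  -- p has the same antisymmetrisation as the derivative of A_i, so the two differ by a symmetric
  -- form, which contributes nothing. The contribution of p itself also vanishes, since each p(v_k)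
  -- is a combination of the A_j with j < i, which repeat a factor.
  let p : E →L[ℝ] E →L[ℝ] ℂ := ∑ j ∈ Finset.Iio i, (η i j).smulRight (A j z)
  have hp : ∀ x, p x = ∑ j ∈ Finset.Iio i, η i j x • A j z := fun x => by simp [p]
  have hsymm : ∀ x y, (fderiv ℝ (A i) z - p) x y = (fderiv ℝ (A i) z - p) y x := by
    intro x y
    have := hη i x y
    rw [Finset.sum_sub_distrib] at this
    simp only [sub_apply, hp, sum_apply,
      smul_apply, smul_eq_mul]
    linear_combination this
  rw [← sum_wedge_update_eq_zero_of_symm (fun i => A i z) i _ hsymm v]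
  refine Finset.sum_congr rfl fun k _ => ?_
  have hzero : wedgeUpdate (fun i => A i z) i (p (v k)) = 0 := by
    rw [hp, map_sum]
    refine Finset.sum_eq_zero fun j hj => ?_
    have hij : i ≠ j := (Finset.mem_Iio.1 hj).ne'
    rw [map_smul, wedgeUpdate_apply, wedge_eq_zero_of_eq _ hij]
    · ext u; exact mul_zero _
    · rw [Function.update_self, Function.update_of_ne hij.symm]
  rw [← wedgeUpdate_apply, ← wedgeUpdate_apply, sub_apply, map_sub, hzero,
    sub_zero]

end WedgeCalculus

/-! ### Forms of type (n,0) on a vector space with complex structure -/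

section ComplexAlternating

variable {V : Type*} [AddCommGroup V] [Module ℝ V] [TopologicalSpace V] {n : ℕ}

/-- Top degree forms of type `(n,0)` are proportional. -/
theorem eq_smul_of_one_zero [FiniteDimensional ℝ V] (hn : Module.finrank ℝ V = 2 * n)
    (J : V →ₗ[ℝ] V) (hJ : ∀ v, J (J v) = -v) {α β : V [⋀^Fin n]→L[ℝ] ℂ}
    (hα : ∀ v i, α (Function.update v i (J (v i))) = Complex.I * α v)
    (hβ : ∀ v i, β (Function.update v i (J (v i))) = Complex.I * β v) (hβ0 : β ≠ 0) :
    ∃ c : ℂ, α = c • β := by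
  -- J makes V a complex vector space of dimension n. Forms of type (n,0) are then complex
  -- multilinear, hence multiples of the determinant in a complex basis.
  let ρ : ℂ →ₐ[ℝ] Module.End ℝ V := Complex.lift ⟨J, LinearMap.ext fun v => by simp [hJ]⟩
  let _ : Module ℂ V := Module.compHom V ρ.toRingHom
  have smul_def : ∀ (c : ℂ) (v : V), c • v = c.re • v + c.im • J v := by
    intro c v
    change ρ c v = _
    simp [ρ, Complex.liftAux_apply]
  have : IsScalarTower ℝ ℂ V := ⟨fun r c v => by simp [smul_def, mul_smul]⟩
  have : Module.Finite ℂ V := Module.Finite.of_restrictScalars_finite ℝ ℂ V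
  have hn' : Module.finrank ℂ V = n := by
    have := Module.finrank_mul_finrank ℝ ℂ V
    rw [Complex.finrank_real_complex] at this
    omega
  let b := Module.finBasisOfFinrankEq ℂ V hn'
  have hlift : ∀ γ : V [⋀^Fin n]→L[ℝ] ℂ,
      (∀ v i, γ (Function.update v i (J (v i))) = Complex.I * γ v) →
      ∃ γ' : V [⋀^Fin n]→ₗ[ℂ] ℂ, ∀ v, γ' v = γ v := by
    intro γ hγ
    refine ⟨AlternatingMap.mk ⟨γ, ?_, ?_⟩ fun v a b h hab => γ.map_eq_zero_of_eq v h hab,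
      fun v => rfl⟩
    · intro inst v i x y
      obtain rfl : inst = instDecidableEqFin n := Subsingleton.elim _ _
      exact γ.toMultilinearMap.map_update_add v i x y
    · intro inst v i c x
      obtain rfl : inst = instDecidableEqFin n := Subsingleton.elim _ _
      have h1 := hγ (Function.update v i x) i
      rw [Function.update_self, Function.update_idem] at h1
      have h2 := γ.toMultilinearMap.map_update_add v i (c.re • x) (c.im • J x)
      have h3 := γ.toMultilinearMap.map_update_smul v i c.re x
      have h4 := γ.toMultilinearMap.map_update_smul v i c.im (J x)
      change γ _ = c • γ _
      rw [smul_def]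
      refine h2.trans ?_
      rw [h3, h4]
      change c.re • γ _ + c.im • γ _ = _
      rw [h1]
      conv_rhs => rw [← Complex.re_add_im c]
      simp only [Complex.real_smul, smul_eq_mul]
      ring
  obtain ⟨α', hα'⟩ := hlift α hα
  obtain ⟨β', hβ'⟩ := hlift β hβ
  have hαb : ∀ v, α v = α b * b.det v := fun v => by
    rw [← hα', ← hα']; exact DFunLike.congr_fun (α'.eq_smul_basis_det b) v
  have hβb : ∀ v, β v = β b * b.det v := fun v => by
    rw [← hβ', ← hβ']; exact DFunLike.congr_fun (β'.eq_smul_basis_det b) v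
  have hb : β b ≠ 0 := fun h => hβ0 (by ext v; rw [hβb, h, zero_mul]; rfl)
  refine ⟨α b / β b, ?_⟩
  ext v
  rw [ContinuousAlternatingMap.smul_apply, hαb, hβb v, smul_eq_mul]
  field_simp

/-- The exterior product of a covector with a nonzero form of type `(n,0)` is of type `(n+1,0)`
exactly if the covector is of type `(1,0)`. -/
theorem sum_one_zero_iff {J : V → V} {τ : V [⋀^Fin n]→L[ℝ] ℂ}
    (hτ : ∀ v i, τ (Function.update v i (J (v i))) = Complex.I * τ v) (hτ0 : τ ≠ 0)
    (D : V → ℂ) (σ : (Fin (n + 1) → V) → ℂ)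
    (hσ : ∀ v, σ v = ∑ k : Fin (n + 1), (-1) ^ (k : ℕ) * (D (v k) * τ (k.removeNth v))) :
    (∀ v i, σ (Function.update v i (J (v i))) = Complex.I * σ v) ↔
      ∀ w, D (J w) = Complex.I * D w := by
  have hrem : ∀ (v : Fin (n + 1) → V) (i k : Fin (n + 1)), k ≠ i →
      τ (k.removeNth (Function.update v i (J (v i)))) = Complex.I * τ (k.removeNth v) := by
    intro v i k hki
    obtain ⟨i, rfl⟩ := Fin.exists_succAbove_eq hki.symm
    rw [← hτ (k.removeNth v) i]
    congr 1
    ext j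
    by_cases h : j = i
    · subst h; simp [Fin.removeNth]
    · simp [Fin.removeNth, h]
  constructor
  · intro H w
    obtain ⟨u, hu⟩ : ∃ u, τ u ≠ 0 := by
      by_contra! hu
      exact hτ0 (ContinuousAlternatingMap.ext hu)
    -- Test on (w, u) with τ(u) ≠ 0. Applying J to w multiplies by i every term in which w is an
    -- argument of τ, so only the term D(w)τ(u) remains to be compared.
    have h := H (Fin.cons w u) 0
    rw [hσ, hσ, Fin.sum_univ_succ, Fin.sum_univ_succ, mul_add, Finset.mul_sum] at h
    have hrest : ∀ k : Fin n, (-1) ^ (k.succ : ℕ) *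
        (D (Function.update (Fin.cons w u : Fin (n + 1) → V) 0
          (J ((Fin.cons w u : Fin (n + 1) → V) 0)) k.succ) *
          τ (k.succ.removeNth (Function.update (Fin.cons w u : Fin (n + 1) → V) 0
            (J ((Fin.cons w u : Fin (n + 1) → V) 0))))) =
        Complex.I * ((-1) ^ (k.succ : ℕ) * (D ((Fin.cons w u : Fin (n + 1) → V) k.succ) *
          τ (k.succ.removeNth (Fin.cons w u : Fin (n + 1) → V)))) := by
      intro k
      rw [hrem _ _ _ (Fin.succ_ne_zero k), Function.update_of_ne (Fin.succ_ne_zero k)]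
      ring
    rw [Finset.sum_congr rfl fun k _ => hrest k, add_left_inj] at h
    have hu' : (Fin.cons w u : Fin (n + 1) → V) ∘ Fin.succ = u := by ext; simp
    simp only [Fin.removeNth_update, Fin.removeNth_zero, Fin.tail_cons, Function.update_self,
      Fin.cons_zero, Fin.val_zero, pow_zero, one_mul] at h
    rw [← mul_assoc] at h
    exact mul_right_cancel₀ hu h
  · intro H v i
    rw [hσ, hσ, Finset.mul_sum]
    refine Finset.sum_congr rfl fun k _ => ?_
    by_cases hki : k = i
    · subst hki
      rw [Function.update_self, H, Fin.removeNth_update]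
      ring
    · rw [hrem _ _ _ hki, Function.update_of_ne hki]
      ring

end ComplexAlternating

/-! ### Forms in the preferred charts -/

section Charts

variable {E : Type*} [NormedAddCommGroup E] [NormedSpace ℝ E]
  {M : Type*} [TopologicalSpace M] [ChartedSpace E M] [IsManifold 𝓘(ℝ, E) ∞ M] {k : ℕ}

/-- The tangent space at x is identified with E through the preferred chart at x itself. Hence
forms, exterior derivatives and brackets at x are read off in this chart without correction terms.
-/
theorem mfderiv_extChartAt_symm_self (x : M) :
    mfderiv 𝓘(ℝ, E) 𝓘(ℝ, E) (extChartAt 𝓘(ℝ, E) x).symm (extChartAt 𝓘(ℝ, E) x x) =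
      ContinuousLinearMap.id ℝ E := by
  have : IsManifold 𝓘(ℝ, E) 1 M := IsManifold.of_le (n := ∞) (by simp)
  have := mfderivWithin_range_extChartAt_symm (I := 𝓘(ℝ, E)) (x := x)
  rwa [ModelWithCorners.range_eq_univ, mfderivWithin_univ] at this

theorem DForm.inChart_self (θ : DForm E M k) (x : M) (v : Fin k → E) :
    θ.inChart x (extChartAt 𝓘(ℝ, E) x x) v = θ x v := by
  rw [DForm.inChart, mfderiv_extChartAt_symm_self, extChartAt_to_inv]
  rfl

theorem DForm.d_apply (θ : DForm E M k) (x : M) (v : Fin (k + 1) → E) :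
    θ.d x v = extDeriv (θ.inChart x) (extChartAt 𝓘(ℝ, E) x x) v := by
  have : IsManifold 𝓘(ℝ, E) 1 M := IsManifold.of_le (n := ∞) (by simp)
  rw [DForm.d, mfderiv_extChartAt_self]
  rfl

omit [IsManifold 𝓘(ℝ, E) ∞ M] in
theorem DForm.IsSmoothOn.contDiffAt {θ : DForm E M k} {U : Set M} (hθ : θ.IsSmoothOn U)
    (hU : IsOpen U) {x : M} (hx : x ∈ U) :
    ContDiffAt ℝ ∞ (θ.inChart x) (extChartAt 𝓘(ℝ, E) x x) := by
  refine (hθ x).contDiffAt (Filter.inter_mem (extChartAt_target_mem_nhds x) ?_)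
  exact (continuousAt_extChartAt_symm x).preimage_mem_nhds
    (hU.mem_nhds (by rwa [extChartAt_to_inv]))

end Charts

/-! ### Closed (n,0)-forms trivialise the canonical bundle -/

section HolomorphicVolumeForm

variable {E : Type*} [NormedAddCommGroup E] [NormedSpace ℝ E]
  {M : Type*} [TopologicalSpace M] [ChartedSpace E M] [IsManifold 𝓘(ℝ, E) ∞ M] {n : ℕ}

theorem DForm.IsSmoothOn.smul {f : M → ℂ} {η : DForm E M n} {U : Set M}
    (hf : ContMDiffOn 𝓘(ℝ, E) 𝓘(ℝ, ℂ) ∞ f U) (hη : η.IsSmoothOn U) :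
    DForm.IsSmoothOn (fun y => f y • η y : DForm E M n) U := by
  intro x₀
  have h1 : ContDiffOn ℝ ∞ (fun z => f ((extChartAt 𝓘(ℝ, E) x₀).symm z))
      ((extChartAt 𝓘(ℝ, E) x₀).target ∩ (extChartAt 𝓘(ℝ, E) x₀).symm ⁻¹' U) :=
    (hf.comp ((contMDiffOn_extChartAt_symm x₀).mono Set.inter_subset_left)
      Set.inter_subset_right).contDiffOn
  have h2 : ContDiffOn ℝ ∞ (η.inChart x₀)
      ((extChartAt 𝓘(ℝ, E) x₀).target ∩ (extChartAt 𝓘(ℝ, E) x₀).symm ⁻¹' U) := hη x₀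
  exact (ContDiffOn.smul h1 h2 :)

/-- Division: if η_x(v) ≠ 0, then in the chart f is (fη)(v) / η(v) near x. -/
theorem contMDiffOn_of_smul {f : M → ℂ} {η : DForm E M n} {U : Set M} (hU : IsOpen U)
    (hη : η.IsSmoothOn Set.univ) (hη0 : ∀ x, η x ≠ 0)
    (hf : DForm.IsSmoothOn (fun y => f y • η y : DForm E M n) U) :
    ContMDiffOn 𝓘(ℝ, E) 𝓘(ℝ, ℂ) ∞ f U := by
  intro x hx
  obtain ⟨v, hv⟩ : ∃ v : Fin n → E, η x v ≠ 0 := by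
    by_contra! h
    exact hη0 x (ContinuousAlternatingMap.ext h)
  have h1 : ContDiffAt ℝ ∞ (fun z => η.inChart x z v) (extChartAt 𝓘(ℝ, E) x x) :=
    (ContinuousAlternatingMap.apply ℝ E ℂ v).contDiff.contDiffAt.comp _
      (hη.contDiffAt isOpen_univ (Set.mem_univ x))
  have h2 : ContDiffAt ℝ ∞ (fun z => f ((extChartAt 𝓘(ℝ, E) x).symm z) * η.inChart x z v)
      (extChartAt 𝓘(ℝ, E) x x) :=
    (ContinuousAlternatingMap.apply ℝ E ℂ v).contDiff.contDiffAt.comp _ (hf.contDiffAt hU hx)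
  have hne : η.inChart x (extChartAt 𝓘(ℝ, E) x x) v ≠ 0 := by rwa [DForm.inChart_self]
  have h3 : ContDiffAt ℝ ∞ (fun z => f ((extChartAt 𝓘(ℝ, E) x).symm z))
      (extChartAt 𝓘(ℝ, E) x x) := by
    refine (h2.mul (h1.inv hne)).congr_of_eventuallyEq ?_
    filter_upwards [h1.continuousAt.eventually_ne hne] with z hz
    simp [hz]
  have h4 : ContMDiffAt 𝓘(ℝ, E) 𝓘(ℝ, ℂ) ∞
      ((fun z => f ((extChartAt 𝓘(ℝ, E) x).symm z)) ∘ extChartAt 𝓘(ℝ, E) x) x :=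
    h3.contMDiffAt.comp x contMDiffAt_extChartAt
  refine (h4.congr_of_eventuallyEq ?_).contMDiffWithinAt
  filter_upwards [extChartAt_source_mem_nhds (I := 𝓘(ℝ, E)) x] with y hy
  exact (congrArg f ((extChartAt 𝓘(ℝ, E) x).left_inv hy)).symm

/-- d(fη) = df ∧ η + f dη, and the last term vanishes at x. The differential enters as `D` on the
model space, which keeps the tangent spaces of ℂ out of the formula. -/
theorem DForm.d_smul_apply {f : M → ℂ} {η : DForm E M n} {x : M} {D : E →L[ℝ] ℂ}
    (hD : mfderiv 𝓘(ℝ, E) 𝓘(ℝ, ℂ) f x = D)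
    (hf : MDifferentiableAt 𝓘(ℝ, E) 𝓘(ℝ, ℂ) f x) (hη : η.IsSmoothOn Set.univ)
    (hdη : η.d x = 0) (v : Fin (n + 1) → E) :
    DForm.d (fun y => f y • η y : DForm E M n) x v =
      ∑ k : Fin (n + 1), (-1) ^ (k : ℕ) *
        (D (v k) * η x (k.removeNth v)) := by
  have h1 : DifferentiableAt ℝ (η.inChart x) (extChartAt 𝓘(ℝ, E) x x) :=
    (hη.contDiffAt isOpen_univ (Set.mem_univ x)).differentiableAt (by simp)
  have h2 : DifferentiableAt ℝ (fun z => f ((extChartAt 𝓘(ℝ, E) x).symm z))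
      (extChartAt 𝓘(ℝ, E) x x) := by
    have := hf.differentiableWithinAt_writtenInExtChartAt
    simpa only [writtenInExtChartAt, Function.comp_def, extChartAt_model_space_eq_id,
      PartialEquiv.refl_coe, id_eq, modelWithCornersSelf_coe, Set.range_id,
      differentiableWithinAt_univ] using this
  have h3 : D =
      fderiv ℝ (fun z => f ((extChartAt 𝓘(ℝ, E) x).symm z)) (extChartAt 𝓘(ℝ, E) x x) := by
    rw [← hD, hf.mfderiv]
    simp only [writtenInExtChartAt, Function.comp_def, extChartAt_model_space_eq_id,
      PartialEquiv.refl_coe, id_eq, modelWithCornersSelf_coe, Set.range_id, fderivWithin_univ]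
  have h4 : extDeriv (η.inChart x) (extChartAt 𝓘(ℝ, E) x x) v = 0 := by
    rw [← DForm.d_apply, hdη]
    rfl
  have h5 : fderiv ℝ (DForm.inChart (fun y => f y • η y : DForm E M n) x)
      (extChartAt 𝓘(ℝ, E) x x) = _ := (h2.hasFDerivAt.smul h1.hasFDerivAt).fderiv
  rw [DForm.d_apply, extDeriv, h5, ContinuousAlternatingMap.alternatizeUncurryFin_apply, ← h3]
  rw [extDeriv, ContinuousAlternatingMap.alternatizeUncurryFin_apply] at h4
  rw [← add_zero (∑ k : Fin (n + 1), (-1) ^ (k : ℕ) * (D (v k) * η x (k.removeNth v))),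
    ← mul_zero (f x), ← h4, Finset.mul_sum, ← Finset.sum_add_distrib]
  refine Finset.sum_congr rfl fun k _ => ?_
  have h6 := DForm.inChart_self η x (k.removeNth v)
  simp only [add_apply, smul_apply, ContinuousLinearMap.smulRight_apply, extChartAt_to_inv,
    ContinuousAlternatingMap.add_apply, ContinuousAlternatingMap.smul_apply, smul_eq_mul,
    zsmul_eq_mul, h6]
  push_cast
  ring

/-- A closed nowhere vanishing form of type `(n,0)` trivialises the canonical bundle. -/
theorem canonicalBundle_trivial_of_closed [FiniteDimensional ℝ E]
    (hn : Module.finrank ℝ E = 2 * n) {J : EndField E M}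
    (hJ : ∀ (x : M) (v : TangentSpace 𝓘(ℝ, E) x), J x (J x v) = -v)
    {η : DForm E M n} (hη : η.IsSmoothOn Set.univ) (hη0 : ∀ x, η x ≠ 0)
    (htype : ∀ x, η x ∈ typeP0 J n x) (hdη : ∀ x, η.d x = 0) :
    CanonicalBundleHolomorphicallyTrivial J n := by
  have hbij : ∀ x, Function.Bijective
      (LinearMap.toSpanSingleton ℂ (typeP0 J n x) ⟨η x, htype x⟩) := by
    intro x
    constructor
    · refine (injective_iff_map_eq_zero _).2 fun c hc => ?_
      have : c • η x = 0 := congrArg Subtype.val hc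
      exact (smul_eq_zero.1 this).resolve_right (hη0 x)
    · rintro ⟨α, hα⟩
      obtain ⟨c, hc⟩ := eq_smul_of_one_zero (V := E) hn (J x).toLinearMap (hJ x) hα (htype x)
        (hη0 x)
      exact ⟨c, Subtype.ext hc.symm⟩
  refine ⟨fun x => LinearEquiv.ofBijective _ (hbij x), fun U hU f => ?_⟩
  have hΦ : (fun x => ((LinearEquiv.ofBijective _ (hbij x) (f x) : typeP0 J n x) :
      TangentSpace 𝓘(ℝ, E) x [⋀^Fin n]→L[ℝ] ℂ)) = (fun y => f y • η y : DForm E M n) := rfl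
  rw [hΦ]
  have hsm : ContMDiffOn 𝓘(ℝ, E) 𝓘(ℝ, ℂ) ∞ f U ↔
      DForm.IsSmoothOn (fun y => f y • η y : DForm E M n) U :=
    ⟨fun hf => DForm.IsSmoothOn.smul hf fun x₀ => (hη x₀).mono (by simp),
      contMDiffOn_of_smul hU hη hη0⟩
  have hdbar : ContMDiffOn 𝓘(ℝ, E) 𝓘(ℝ, ℂ) ∞ f U → ∀ x ∈ U,
      ((DForm.d (fun y => f y • η y : DForm E M n) x ∈ typeP0 J (n + 1) x) ↔
        ∀ v : TangentSpace 𝓘(ℝ, E) x,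
          NormedSpace.fromTangentSpace (𝕜 := ℝ) (f x)
              (mfderiv 𝓘(ℝ, E) 𝓘(ℝ, ℂ) f x (J x v)) =
            Complex.I * NormedSpace.fromTangentSpace (𝕜 := ℝ) (f x)
              (mfderiv 𝓘(ℝ, E) 𝓘(ℝ, ℂ) f x v)) := by
    intro hf x hx
    have hfx : MDifferentiableAt 𝓘(ℝ, E) 𝓘(ℝ, ℂ) f x :=
      (hf.contMDiffAt (hU.mem_nhds hx)).mdifferentiableAt (by simp)
    exact sum_one_zero_iff (V := E) (J := J x) (htype x) (hη0 x)
      (fun w => (mfderiv 𝓘(ℝ, E) 𝓘(ℝ, ℂ) f x : E →L[ℝ] ℂ) w) _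
      (DForm.d_smul_apply rfl hfx hη (hdη x))
  constructor
  · rintro ⟨hf, hcr⟩
    exact ⟨hsm.1 hf, fun x _ => Submodule.smul_mem _ _ (htype x),
      fun x hx => (hdbar hf x hx).2 (hcr x hx)⟩
  · rintro ⟨hs, -, hd⟩
    exact ⟨hsm.2 hs, fun x hx => (hdbar (hsm.2 hs) x hx).1 (hd x hx)⟩

end HolomorphicVolumeForm

/-! ### One-forms, vector fields and Cartan's formula in charts -/

section ChartCalculus

variable {E : Type*} [NormedAddCommGroup E] [NormedSpace ℝ E]
  {M : Type*} [TopologicalSpace M] [ChartedSpace E M]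

/-- The coordinate expression of a `1`-form in the preferred chart at `x₀`. -/
def OneForm.inChart (α : OneForm E M) (x₀ : M) (z : E) : E →L[ℝ] ℂ :=
  (α ((extChartAt 𝓘(ℝ, E) x₀).symm z)).comp
    (mfderiv 𝓘(ℝ, E) 𝓘(ℝ, E) (extChartAt 𝓘(ℝ, E) x₀).symm z)

theorem OneForm.toDForm_inChart (α : OneForm E M) (x₀ : M) :
    α.toDForm.inChart x₀ =
      fun z => ContinuousAlternatingMap.ofSubsingletonLIE (𝕜 := ℝ) (E := E) (F := ℂ) (0 : Fin 1) (α.inChart x₀ z) := by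
  ext z v
  rfl

theorem wedge_inChart {n : ℕ} (θ : Fin n → OneForm E M) (x₀ : M) :
    DForm.inChart (fun x => wedge fun i => θ i x : DForm E M n) x₀ =
      fun z => wedge fun i => (θ i).inChart x₀ z := by
  ext1 z
  exact wedge_compContinuousLinearMap _ _

theorem OneForm.toDForm_isSmoothOn_iff (α : OneForm E M) (U : Set M) :
    α.toDForm.IsSmoothOn U ↔ ∀ x₀ : M, ContDiffOn ℝ ∞ (α.inChart x₀)
      ((extChartAt 𝓘(ℝ, E) x₀).target ∩ (extChartAt 𝓘(ℝ, E) x₀).symm ⁻¹' U) := by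
  refine forall_congr' fun x₀ => ?_
  rw [OneForm.toDForm_inChart]
  exact (ContinuousAlternatingMap.ofSubsingletonLIE (𝕜 := ℝ) (E := E) (F := ℂ)
    (0 : Fin 1)).toContinuousLinearEquiv.comp_contDiffOn_iff

theorem OneForm.differentiableAt_inChart {α : OneForm E M} (hα : α.toDForm.IsSmoothOn Set.univ)
    (x : M) : DifferentiableAt ℝ (α.inChart x) (extChartAt 𝓘(ℝ, E) x x) := by
  have h := ((OneForm.toDForm_isSmoothOn_iff α _).1 hα x).contDiffAt (x := extChartAt 𝓘(ℝ, E) x x)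
    (Filter.inter_mem (extChartAt_target_mem_nhds x) (by simp))
  exact h.differentiableAt (by simp)

variable [IsManifold 𝓘(ℝ, E) ∞ M]

theorem OneForm.inChart_self (α : OneForm E M) (x : M) (v : E) :
    α.inChart x (extChartAt 𝓘(ℝ, E) x x) v = α x v := by
  rw [OneForm.inChart, mfderiv_extChartAt_symm_self, extChartAt_to_inv]
  rfl

theorem OneForm.d_toDForm_apply {α : OneForm E M} (hα : α.toDForm.IsSmoothOn Set.univ) (x : M)
    (v : Fin 2 → E) :
    α.toDForm.d x v = fderiv ℝ (α.inChart x) (extChartAt 𝓘(ℝ, E) x x) (v 0) (v 1) -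
      fderiv ℝ (α.inChart x) (extChartAt 𝓘(ℝ, E) x x) (v 1) (v 0) := by
  have h := OneForm.differentiableAt_inChart hα x
  have h' : fderiv ℝ (α.toDForm.inChart x) (extChartAt 𝓘(ℝ, E) x x) =
      ((ContinuousAlternatingMap.ofSubsingletonLIE (𝕜 := ℝ) (E := E) (F := ℂ)
        (0 : Fin 1)).toContinuousLinearEquiv : (E →L[ℝ] ℂ) →L[ℝ] E [⋀^Fin 1]→L[ℝ] ℂ).comp
        (fderiv ℝ (α.inChart x) (extChartAt 𝓘(ℝ, E) x x)) := by
    rw [OneForm.toDForm_inChart]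
    exact ((ContinuousAlternatingMap.ofSubsingletonLIE (𝕜 := ℝ) (E := E) (F := ℂ)
      (0 : Fin 1)).toContinuousLinearEquiv.hasFDerivAt.comp _ h.hasFDerivAt).fderiv
  rw [DForm.d_apply, extDeriv, ContinuousAlternatingMap.alternatizeUncurryFin_apply, h',
    Fin.sum_univ_two]
  change (-1) ^ 0 • fderiv ℝ (α.inChart x) (extChartAt 𝓘(ℝ, E) x x) (v 0) (v 1) +
    (-1) ^ 1 • fderiv ℝ (α.inChart x) (extChartAt 𝓘(ℝ, E) x x) (v 1) (v 0) = _
  simp [sub_eq_add_neg]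

/-- The coordinate expression of a vector field in the preferred chart at `x₀`. -/
def fieldInChart (V : ∀ x : M, TangentSpace 𝓘(ℝ, E) x) (x₀ : M) (z : E) : E :=
  (mfderiv 𝓘(ℝ, E) 𝓘(ℝ, E) (extChartAt 𝓘(ℝ, E) x₀).symm z).inverse
    (V ((extChartAt 𝓘(ℝ, E) x₀).symm z))

omit [IsManifold 𝓘(ℝ, E) ∞ M] in
theorem fieldInChart_eq_mpullbackWithin (V : ∀ x : M, TangentSpace 𝓘(ℝ, E) x) (x₀ : M) :
    fieldInChart V x₀ = VectorField.mpullbackWithin 𝓘(ℝ, E) 𝓘(ℝ, E) (extChartAt 𝓘(ℝ, E) x₀).symm V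
      (Set.range 𝓘(ℝ, E)) := by
  rw [ModelWithCorners.range_eq_univ, VectorField.mpullbackWithin_univ]
  rfl

theorem fieldInChart_self (V : ∀ x : M, TangentSpace 𝓘(ℝ, E) x) (x : M) :
    fieldInChart V x (extChartAt 𝓘(ℝ, E) x x) = V x := by
  rw [fieldInChart, mfderiv_extChartAt_symm_self, extChartAt_to_inv]
  erw [ContinuousLinearMap.inverse_id]
  rfl

theorem isInvertible_mfderiv_extChartAt_symm {x₀ : M} {z : E}
    (hz : z ∈ (extChartAt 𝓘(ℝ, E) x₀).target) :
    (mfderiv 𝓘(ℝ, E) 𝓘(ℝ, E) (extChartAt 𝓘(ℝ, E) x₀).symm z).IsInvertible := by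
  have : IsManifold 𝓘(ℝ, E) 1 M := IsManifold.of_le (n := ∞) (by simp)
  have := isInvertible_mfderivWithin_extChartAt_symm hz
  rwa [ModelWithCorners.range_eq_univ, mfderivWithin_univ] at this

/-- The pairing does not depend on the chart, so a constant α(V) stays constant in coordinates. -/
theorem OneForm.inChart_fieldInChart (α : OneForm E M) (V : ∀ x : M, TangentSpace 𝓘(ℝ, E) x)
    {x₀ : M} {z : E} (hz : z ∈ (extChartAt 𝓘(ℝ, E) x₀).target) :
    α.inChart x₀ z (fieldInChart V x₀ z) =
      α ((extChartAt 𝓘(ℝ, E) x₀).symm z) (V ((extChartAt 𝓘(ℝ, E) x₀).symm z)) := by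
  have := (isInvertible_mfderiv_extChartAt_symm hz).self_apply_inverse
    (V ((extChartAt 𝓘(ℝ, E) x₀).symm z))
  exact congrArg (α _) this

theorem differentiableAt_fieldInChart [CompleteSpace E] {V : ∀ x : M, TangentSpace 𝓘(ℝ, E) x} {x : M}
    (hV : MDifferentiableAt 𝓘(ℝ, E) 𝓘(ℝ, E).tangent
      (fun y => (⟨y, V y⟩ : TangentBundle 𝓘(ℝ, E) M)) x) :
    DifferentiableAt ℝ (fieldInChart V x) (extChartAt 𝓘(ℝ, E) x x) := by
  have : IsManifold 𝓘(ℝ, E) 2 M := IsManifold.of_le (n := ∞) (WithTop.coe_le_coe.2 le_top)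
  have h := hV.mdifferentiableWithinAt (s := Set.univ)
    |>.differentiableWithinAt_mpullbackWithin_vectorField
  rw [← fieldInChart_eq_mpullbackWithin] at h
  rwa [Set.preimage_univ, Set.univ_inter, ModelWithCorners.range_eq_univ,
    differentiableWithinAt_univ] at h

theorem mlieBracket_eq_fderiv (V W : ∀ x : M, TangentSpace 𝓘(ℝ, E) x) (x : M) :
    VectorField.mlieBracket 𝓘(ℝ, E) V W x =
      fderiv ℝ (fieldInChart W x) (extChartAt 𝓘(ℝ, E) x x) (V x) -
        fderiv ℝ (fieldInChart V x) (extChartAt 𝓘(ℝ, E) x x) (W x) := by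
  have : IsManifold 𝓘(ℝ, E) 1 M := IsManifold.of_le (n := ∞) (by simp)
  rw [← VectorField.mlieBracketWithin_univ, VectorField.mlieBracketWithin_apply,
    mfderiv_extChartAt_self, ← fieldInChart_eq_mpullbackWithin, ← fieldInChart_eq_mpullbackWithin]
  erw [ContinuousLinearMap.inverse_id]
  simp only [Set.preimage_univ, Set.univ_inter, ModelWithCorners.range_eq_univ,
    VectorField.lieBracketWithin_univ, VectorField.lieBracket, fieldInChart_self]
  rfl

/-- Cartan's formula for a `1`-form which is constant on two vector fields. -/
theorem OneForm.d_apply_of_const [CompleteSpace E] {α : OneForm E M}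
    (hα : α.toDForm.IsSmoothOn Set.univ) {V W : ∀ x : M, TangentSpace 𝓘(ℝ, E) x} {x : M}
    (hV : MDifferentiableAt 𝓘(ℝ, E) 𝓘(ℝ, E).tangent
      (fun y => (⟨y, V y⟩ : TangentBundle 𝓘(ℝ, E) M)) x)
    (hW : MDifferentiableAt 𝓘(ℝ, E) 𝓘(ℝ, E).tangent
      (fun y => (⟨y, W y⟩ : TangentBundle 𝓘(ℝ, E) M)) x)
    {a b : ℂ} (ha : ∀ y, α y (V y) = a) (hb : ∀ y, α y (W y) = b) :
    α.toDForm.d x (![V x, W x] : Fin 2 → E) = -α x (VectorField.mlieBracket 𝓘(ℝ, E) V W x) := by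
  have hA := OneForm.differentiableAt_inChart hα x
  -- Differentiating the constant function α(V) in direction w gives (D_w α)(V) = -α(D_w V).
  -- Antisymmetrised, this is Cartan's formula.
  have key : ∀ {V : ∀ x : M, TangentSpace 𝓘(ℝ, E) x} {a : ℂ},
      MDifferentiableAt 𝓘(ℝ, E) 𝓘(ℝ, E).tangent
        (fun y => (⟨y, V y⟩ : TangentBundle 𝓘(ℝ, E) M)) x → (∀ y, α y (V y) = a) → ∀ w : E,
      fderiv ℝ (α.inChart x) (extChartAt 𝓘(ℝ, E) x x) w (V x) =
        -α x (fderiv ℝ (fieldInChart V x) (extChartAt 𝓘(ℝ, E) x x) w) := by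
    intro V a hV ha w
    have h1 := hA.hasFDerivAt.clm_apply (differentiableAt_fieldInChart hV).hasFDerivAt
    have h2 : HasFDerivAt (fun z => α.inChart x z (fieldInChart V x z)) (0 : E →L[ℝ] ℂ)
        (extChartAt 𝓘(ℝ, E) x x) := by
      refine (hasFDerivAt_const a _).congr_of_eventuallyEq ?_
      filter_upwards [extChartAt_target_mem_nhds (I := 𝓘(ℝ, E)) x] with z hz
      rw [OneForm.inChart_fieldInChart α V hz, ha]
    have h3 := DFunLike.congr_fun (h1.unique h2) w
    simp only [add_apply, ContinuousLinearMap.comp_apply,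
      fieldInChart_self, OneForm.inChart_self] at h3
    exact eq_neg_of_add_eq_zero_right h3
  rw [OneForm.d_toDForm_apply hα, mlieBracket_eq_fderiv]
  refine (congrArg₂ (· - ·) (key hW hb (V x)) (key hV ha (W x))).trans ?_
  refine Eq.trans ?_ (congrArg Neg.neg ((α x).map_sub _ _)).symm
  ring

end ChartCalculus

/-! ### Left translations and left-invariant forms -/

section LieGroup

variable {E : Type*} [NormedAddCommGroup E] [NormedSpace ℝ E]
  {G : Type*} [TopologicalSpace G] [ChartedSpace E G] [Group G] [LieGroup 𝓘(ℝ, E) ∞ G]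

/-- The differential at `h` of the left translation by `g`, in the model space. -/
def leftDifferential (g h : G) : E →L[ℝ] E := mfderiv 𝓘(ℝ, E) 𝓘(ℝ, E) (fun y : G => g * y) h

theorem mdifferentiableAt_mul_left (g h : G) :
    MDifferentiableAt 𝓘(ℝ, E) 𝓘(ℝ, E) (fun y : G => g * y) h :=
  (contMDiff_mul_left (n := ∞)).contMDiffAt.mdifferentiableAt (by simp)

theorem leftDifferential_comp (g h k : G) :
    (leftDifferential (E := E) g (h * k)).comp (leftDifferential h k) =
      leftDifferential (g * h) k := by
  have := mfderiv_comp (I := 𝓘(ℝ, E)) (I' := 𝓘(ℝ, E)) (I'' := 𝓘(ℝ, E)) k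
    (mdifferentiableAt_mul_left g (h * k)) (mdifferentiableAt_mul_left h k)
  have e : (fun y : G => g * y) ∘ (fun y : G => h * y) = fun y => g * h * y := by
    ext y; simp [mul_assoc]
  rw [e] at this
  exact this.symm

omit [LieGroup 𝓘(ℝ, E) ∞ G] in
theorem leftDifferential_one (h : G) :
    leftDifferential (E := E) 1 h = ContinuousLinearMap.id ℝ E := by
  have : (fun y : G => 1 * y) = id := by ext; simp
  rw [leftDifferential, this, mfderiv_id]
  rfl

theorem leftDifferential_comp_apply (g h k : G) (v : E) :
    leftDifferential g (h * k) (leftDifferential h k v) = leftDifferential (g * h) k v :=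
  DFunLike.congr_fun (leftDifferential_comp g h k) v

theorem leftDifferential_surjective (g : G) (v : E) :
    ∃ w : E, leftDifferential g 1 w = v := by
  refine ⟨leftDifferential g⁻¹ g v, ?_⟩
  have := leftDifferential_comp_apply g g⁻¹ g v
  rwa [inv_mul_cancel, mul_inv_cancel, leftDifferential_one] at this

omit [LieGroup 𝓘(ℝ, E) ∞ G] in
theorem isLeftInvariant_toDForm_iff (α : G → E →L[ℝ] ℂ) :
    (OneForm.toDForm (E := E) α).IsLeftInvariant ↔
      ∀ g h v, α (g * h) (leftDifferential g h v) = α h v := by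
  constructor
  · intro H g h v
    exact DFunLike.congr_fun (H g h) fun _ => v
  · intro H g h
    ext v
    exact H g h (v 0)

omit [LieGroup 𝓘(ℝ, E) ∞ G] in
theorem apply_leftDifferential_one {α : G → E →L[ℝ] ℂ}
    (hα : (OneForm.toDForm (E := E) α).IsLeftInvariant) (g : G) (v : E) :
    α g (leftDifferential g 1 v) = α 1 v := by
  simpa using (isLeftInvariant_toDForm_iff α).1 hα g 1 v

/-- The left-invariant `1`-form with a given value at the identity. -/
def leftInvariantForm (ξ : E →L[ℝ] ℂ) : G → E →L[ℝ] ℂ :=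
  fun g => ξ.comp (leftDifferential g⁻¹ g)

theorem leftInvariantForm_isLeftInvariant (ξ : E →L[ℝ] ℂ) :
    (OneForm.toDForm (E := E) (leftInvariantForm (G := G) ξ)).IsLeftInvariant := by
  refine (isLeftInvariant_toDForm_iff _).2 fun g h v => ?_
  change ξ (leftDifferential (g * h)⁻¹ (g * h) (leftDifferential g h v)) =
    ξ (leftDifferential h⁻¹ h v)
  rw [leftDifferential_comp_apply, mul_inv_rev, inv_mul_cancel_right]

omit [LieGroup 𝓘(ℝ, E) ∞ G] in
theorem leftInvariantForm_one (ξ : E →L[ℝ] ℂ) (v : E) :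
    leftInvariantForm (G := G) ξ 1 v = ξ v := by
  change ξ (leftDifferential (1 : G)⁻¹ 1 v) = ξ v
  rw [inv_one, leftDifferential_one]
  rfl

theorem mfderiv_extChartAt_of_eq {M : Type*} [TopologicalSpace M] [ChartedSpace E M]
    [IsManifold 𝓘(ℝ, E) ∞ M] {x y : M} (h : y = x) :
    mfderiv 𝓘(ℝ, E) 𝓘(ℝ, E) (extChartAt 𝓘(ℝ, E) x) y = ContinuousLinearMap.id ℝ E := by
  subst h
  have : IsManifold 𝓘(ℝ, E) 1 M := IsManifold.of_le (n := ∞) (by simp)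
  exact mfderiv_extChartAt_self

theorem contMDiffAt_extChartAt_symm {M : Type*} [TopologicalSpace M] [ChartedSpace E M]
    [IsManifold 𝓘(ℝ, E) ∞ M] {x : M} {z : E} (hz : z ∈ (extChartAt 𝓘(ℝ, E) x).target) :
    ContMDiffAt 𝓘(ℝ, E) 𝓘(ℝ, E) ∞ (extChartAt 𝓘(ℝ, E) x).symm z :=
  (contMDiffOn_extChartAt_symm x).contMDiffAt ((isOpen_extChartAt_target x).mem_nhds hz)

/-- Left-invariant `1`-forms are smooth. -/
theorem isSmoothOn_of_isLeftInvariant {α : G → E →L[ℝ] ℂ}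
    (hα : (OneForm.toDForm (E := E) α).IsLeftInvariant) :
    (OneForm.toDForm (E := E) α).IsSmoothOn Set.univ := by
  refine (OneForm.toDForm_isSmoothOn_iff _ _).2 fun x₀ => ?_
  rw [Set.preimage_univ, Set.inter_univ]
  let ψ := (extChartAt 𝓘(ℝ, E) x₀).symm
  -- Left-invariance writes α at ψ(z) as α_1 composed with the derivative of w ↦ φ(ψ(z)⁻¹ψ(w)) at w
  -- = z, with φ the chart at 1. This map is jointly smooth near the diagonal, so its partial
  -- derivative depends smoothly on z.
  let F : E → E → E := fun z w => extChartAt 𝓘(ℝ, E) (1 : G) ((ψ z)⁻¹ * ψ w)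
  have hF : ∀ z ∈ (extChartAt 𝓘(ℝ, E) x₀).target,
      ContDiffAt ℝ ∞ (Function.uncurry F) (z, z) := by
    intro z hz
    have hψ := contMDiffAt_extChartAt_symm hz
    have h1 : ContMDiffAt 𝓘(ℝ, E × E) 𝓘(ℝ, E) ∞ (fun p : E × E => ψ p.1) (z, z) :=
      ContMDiffAt.comp (z, z) hψ contDiffAt_fst.contMDiffAt
    have h2 : ContMDiffAt 𝓘(ℝ, E × E) 𝓘(ℝ, E) ∞ (fun p : E × E => ψ p.2) (z, z) :=
      ContMDiffAt.comp (z, z) hψ contDiffAt_snd.contMDiffAt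
    have h3 := h1.inv.mul h2
    have h4 : ContMDiffAt 𝓘(ℝ, E) 𝓘(ℝ, E) ∞ (extChartAt 𝓘(ℝ, E) (1 : G)) ((ψ z)⁻¹ * ψ z) := by
      rw [inv_mul_cancel]
      exact contMDiffAt_extChartAt
    exact (ContMDiffAt.comp (z, z) h4 h3).contDiffAt
  have hder : ∀ z ∈ (extChartAt 𝓘(ℝ, E) x₀).target,
      OneForm.inChart α x₀ z = (α 1).comp (fderiv ℝ (F z) z) := by
    intro z hz
    have hψ := (contMDiffAt_extChartAt_symm hz).mdifferentiableAt (by simp)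
    have hL := mdifferentiableAt_mul_left (E := E) (ψ z)⁻¹ (ψ z)
    have hφ : MDifferentiableAt 𝓘(ℝ, E) 𝓘(ℝ, E) (extChartAt 𝓘(ℝ, E) (1 : G))
        ((ψ z)⁻¹ * ψ z) := by
      rw [inv_mul_cancel]
      exact (contMDiffAt_extChartAt (n := ∞)).mdifferentiableAt (by simp)
    have e1 : mfderiv 𝓘(ℝ, E) 𝓘(ℝ, E) (fun w => (ψ z)⁻¹ * ψ w) z =
        (leftDifferential (E := E) (ψ z)⁻¹ (ψ z)).comp (mfderiv 𝓘(ℝ, E) 𝓘(ℝ, E) ψ z) :=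
      mfderiv_comp z hL hψ
    have e2 : mfderiv 𝓘(ℝ, E) 𝓘(ℝ, E) (F z) z =
        (mfderiv 𝓘(ℝ, E) 𝓘(ℝ, E) (extChartAt 𝓘(ℝ, E) (1 : G)) ((ψ z)⁻¹ * ψ z)).comp
          (mfderiv 𝓘(ℝ, E) 𝓘(ℝ, E) (fun w => (ψ z)⁻¹ * ψ w) z) :=
      mfderiv_comp z hφ (hL.comp z hψ)
    rw [e1, mfderiv_extChartAt_of_eq (inv_mul_cancel _), mfderiv_eq_fderiv] at e2
    rw [e2]
    ext v
    change α (ψ z) _ = α 1 (leftDifferential (E := E) (ψ z)⁻¹ (ψ z) _)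
    have := (isLeftInvariant_toDForm_iff (E := E) α).1 hα (ψ z)⁻¹ (ψ z)
      (mfderiv 𝓘(ℝ, E) 𝓘(ℝ, E) ψ z v)
    rw [inv_mul_cancel] at this
    exact this.symm
  refine ContDiffOn.congr (fun z hz => ContDiffAt.contDiffWithinAt ?_) hder
  exact contDiffAt_const.clm_comp (ContDiffAt.fderiv (hF z hz) contDiffAt_id (by simp))

end LieGroup

/-! ### Second derivatives of a local group law -/

section BracketCalculus

variable {E : Type*} [NormedAddCommGroup E] [NormedSpace ℝ E]

/-- The derivative at the unit of the conjugation `c` of a local group law `F` is the commutator of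
the second derivative of `F`. -/
theorem fderiv_conj_eq_commutator {F c : E → E → E} {p : E}
    (hF : ContDiffAt ℝ ∞ (Function.uncurry F) (p, p))
    (hc : ContDiffAt ℝ ∞ (Function.uncurry c) (p, p))
    (hFl : ∀ᶠ x in 𝓝 p, F x p = x) (hcp : ∀ᶠ a in 𝓝 p, c a p = p)
    (hcr : ∀ᶠ b in 𝓝 p, c p b = b)
    (hcF : ∀ᶠ q : E × E in 𝓝 (p, p), F (c q.1 q.2) q.1 = F q.1 q.2) (X Y : E) :
    fderiv ℝ (fun a => fderiv ℝ (c a) p) p X Y =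
      fderiv ℝ (fun a => fderiv ℝ (F a) p) p X Y - fderiv ℝ (fun a => fderiv ℝ (F a) p) p Y X := by
  have hF2 : ContDiffAt ℝ ∞ (Function.uncurry fun a x => F x a) (p, p) :=
    ContDiffAt.comp (p, p) hF (contDiffAt_snd.prodMk contDiffAt_fst)
  have hQ : DifferentiableAt ℝ (fun a => fderiv ℝ (c a) p) p :=
    (ContDiffAt.fderiv (m := ∞) hc contDiffAt_const
      (by simp)).differentiableAt (by simp)
  have hR : DifferentiableAt ℝ (fun a => fderiv ℝ (F a) p) p :=
    (ContDiffAt.fderiv (m := ∞) hF contDiffAt_const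
      (by simp)).differentiableAt (by simp)
  have hP : DifferentiableAt ℝ (fun a => fderiv ℝ (fun x => F x a) p) p :=
    (ContDiffAt.fderiv (m := ∞) hF2 contDiffAt_const
      (by simp)).differentiableAt (by simp)
  have hPp : fderiv ℝ (fun x => F x p) p = ContinuousLinearMap.id ℝ E := by
    rw [Filter.EventuallyEq.fderiv_eq (f₁ := fun x => F x p) (f := id) hFl, fderiv_id]
  have hQp : fderiv ℝ (c p) p = ContinuousLinearMap.id ℝ E := by
    rw [Filter.EventuallyEq.fderiv_eq (f₁ := c p) (f := id) hcr, fderiv_id]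
  have hdiff : ∀ {H : E → E → E}, ContDiffAt ℝ ∞ (Function.uncurry H) (p, p) →
      ∀ᶠ q : E × E in 𝓝 (p, p), DifferentiableAt ℝ (Function.uncurry H) q := by
    intro H hH
    have h1 : ContDiffAt ℝ 1 (Function.uncurry H) (p, p) := hH.of_le (by simp)
    exact (h1.eventually (by simp)).mono fun q hq => hq.differentiableAt (by simp)
  have hdiag : Filter.Tendsto (fun a : E => (a, p)) (𝓝 p) (𝓝 (p, p)) :=
    (Continuous.prodMk continuous_id continuous_const).tendsto' _ _ rfl
  have hdiag' : Filter.Tendsto (fun a : E => (p, a)) (𝓝 p) (𝓝 (p, p)) :=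
    (Continuous.prodMk continuous_const continuous_id).tendsto' _ _ rfl
  -- Differentiate F(c(a, b), a) = F(a, b) in b at p, using c(a, p) = p.
  have hPQR : (fun a => (fderiv ℝ (fun x => F x a) p).comp (fderiv ℝ (c a) p)) =ᶠ[𝓝 p]
      fun a => fderiv ℝ (F a) p := by
    filter_upwards [hcp, hdiag.eventually hcF.eventually_nhds, hdiag.eventually (hdiff hc),
      hdiag'.eventually (hdiff hF)] with a h1 h2 h3 h4
    have h5 : (fun b => F (c a b) a) =ᶠ[𝓝 p] F a :=
      ((Continuous.prodMk continuous_const continuous_id).tendsto' p (a, p) rfl).eventually h2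
    have h6 : DifferentiableAt ℝ (c a) p :=
      DifferentiableAt.comp p (f := fun b => (a, b)) h3
        ((differentiableAt_const a).prodMk differentiableAt_id)
    have h7 : DifferentiableAt ℝ (fun x => F x a) (c a p) := by
      rw [h1]
      exact DifferentiableAt.comp p (f := fun x => (x, a)) h4
        (differentiableAt_id.prodMk (differentiableAt_const a))
    rw [← h5.fderiv_eq]
    have := fderiv_comp p h7 h6
    rw [h1] at this
    exact this.symm
  -- Now differentiate in a at p, where both factors on the left are the identity.
  have hder := (hP.hasFDerivAt.clm_comp hQ.hasFDerivAt).congr_of_eventuallyEq hPQR.symm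
  have h8 := DFunLike.congr_fun (DFunLike.congr_fun (hder.unique hR.hasFDerivAt) X) Y
  have hsymm : IsSymmSndFDerivAt ℝ (Function.uncurry F) (p, p) :=
    hF.isSymmSndFDerivAt (by simpa using ENat.LEInfty.out)
  have hD2 : DifferentiableAt ℝ (fderiv ℝ (Function.uncurry F)) (p, p) :=
    (hF.fderiv_right (m := ∞) (by simp)).differentiableAt (by simp)
  -- This and `h10` are the two orders of the same mixed second derivative of F; its symmetry turns
  -- the derivative of ∂₁F into that of ∂₂F with X and Y exchanged.
  have h9 : fderiv ℝ (fun a => fderiv ℝ (fun x => F x a) p) p X Y =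
      fderiv ℝ (fderiv ℝ (Function.uncurry F)) (p, p) (0, X) (Y, 0) := by
    have e : (fun a => fderiv ℝ (fun x => F x a) p) =ᶠ[𝓝 p] fun a =>
        (fderiv ℝ (Function.uncurry F) (p, a)).comp (ContinuousLinearMap.inl ℝ E E) := by
      filter_upwards [hdiag'.eventually (hdiff hF)] with a ha
      exact (HasFDerivAt.comp p (f := fun x => (x, a)) ha.hasFDerivAt
        (hasFDerivAt_prodMk_left p a)).fderiv
    rw [e.fderiv_eq]
    have h := (HasFDerivAt.comp p hD2.hasFDerivAt (hasFDerivAt_prodMk_right p p)).clm_comp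
      (hasFDerivAt_const (ContinuousLinearMap.inl ℝ E E) p)
    rw [(show HasFDerivAt (fun a => (fderiv ℝ (Function.uncurry F) (p, a)).comp
      (ContinuousLinearMap.inl ℝ E E)) _ p from h).fderiv]
    simp
  have h10 : fderiv ℝ (fun a => fderiv ℝ (F a) p) p Y X =
      fderiv ℝ (fderiv ℝ (Function.uncurry F)) (p, p) (Y, 0) (0, X) := by
    have e : (fun a => fderiv ℝ (F a) p) =ᶠ[𝓝 p] fun a =>
        (fderiv ℝ (Function.uncurry F) (a, p)).comp (ContinuousLinearMap.inr ℝ E E) := by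
      filter_upwards [hdiag.eventually (hdiff hF)] with a ha
      exact (HasFDerivAt.comp p ha.hasFDerivAt (hasFDerivAt_prodMk_right a p)).fderiv
    rw [e.fderiv_eq]
    have h := (HasFDerivAt.comp p (f := fun a => (a, p)) hD2.hasFDerivAt
      (hasFDerivAt_prodMk_left p p)).clm_comp
      (hasFDerivAt_const (ContinuousLinearMap.inr ℝ E E) p)
    rw [(show HasFDerivAt (fun a => (fderiv ℝ (Function.uncurry F) (a, p)).comp
      (ContinuousLinearMap.inr ℝ E E)) _ p from h).fderiv]
    simp
  rw [h10, ← hsymm.eq, ← h9, ← h8, hPp, hQp]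
  simp

end BracketCalculus

/-! ### The adjoint representation and its derivative -/

section Adjoint

variable {E : Type*} [NormedAddCommGroup E] [NormedSpace ℝ E]
  {G : Type*} [TopologicalSpace G] [ChartedSpace E G] [Group G]

variable (E) in
/-- The group law in the preferred chart at the identity. -/
def chartMul (G : Type*) [TopologicalSpace G] [ChartedSpace E G] [Group G] (a b : E) : E :=
  extChartAt 𝓘(ℝ, E) (1 : G)
    ((extChartAt 𝓘(ℝ, E) (1 : G)).symm a * (extChartAt 𝓘(ℝ, E) (1 : G)).symm b)

variable (E) in
/-- The conjugation in the preferred chart at the identity. -/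
def chartConj (G : Type*) [TopologicalSpace G] [ChartedSpace E G] [Group G] (a b : E) : E :=
  extChartAt 𝓘(ℝ, E) (1 : G)
    ((extChartAt 𝓘(ℝ, E) (1 : G)).symm a * (extChartAt 𝓘(ℝ, E) (1 : G)).symm b *
      ((extChartAt 𝓘(ℝ, E) (1 : G)).symm a)⁻¹)

/-- The adjoint representation. -/
def adjoint (g : G) : E →L[ℝ] E := mfderiv 𝓘(ℝ, E) 𝓘(ℝ, E) (fun x : G => g * x * g⁻¹) 1

variable [LieGroup 𝓘(ℝ, E) ∞ G]

omit [LieGroup 𝓘(ℝ, E) ∞ G] in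
theorem contDiffAt_chart_of_contMDiffAt {f : E × E → G} {q : E × E} (hfq : f q = 1)
    (hf : ContMDiffAt 𝓘(ℝ, E × E) 𝓘(ℝ, E) ∞ f q) :
    ContDiffAt ℝ ∞ (fun q => extChartAt 𝓘(ℝ, E) (1 : G) (f q)) q := by
  have h : ContMDiffAt 𝓘(ℝ, E) 𝓘(ℝ, E) ∞ (extChartAt 𝓘(ℝ, E) (1 : G)) (f q) := by
    rw [hfq]
    exact contMDiffAt_extChartAt
  exact (ContMDiffAt.comp q h hf).contDiffAt

theorem contMDiffAt_chart_symm_fst (q : E × E) (hq : q.1 = extChartAt 𝓘(ℝ, E) (1 : G) 1) :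
    ContMDiffAt 𝓘(ℝ, E × E) 𝓘(ℝ, E) ∞
      (fun q : E × E => (extChartAt 𝓘(ℝ, E) (1 : G)).symm q.1) q :=
  ContMDiffAt.comp q (contMDiffAt_extChartAt_symm (by rw [hq]; exact mem_extChartAt_target _))
    contDiffAt_fst.contMDiffAt

theorem contMDiffAt_chart_symm_snd (q : E × E) (hq : q.2 = extChartAt 𝓘(ℝ, E) (1 : G) 1) :
    ContMDiffAt 𝓘(ℝ, E × E) 𝓘(ℝ, E) ∞
      (fun q : E × E => (extChartAt 𝓘(ℝ, E) (1 : G)).symm q.2) q :=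
  ContMDiffAt.comp q (contMDiffAt_extChartAt_symm (by rw [hq]; exact mem_extChartAt_target _))
    contDiffAt_snd.contMDiffAt

theorem contDiffAt_chartMul :
    ContDiffAt ℝ ∞ (Function.uncurry (chartMul E G))
      (extChartAt 𝓘(ℝ, E) (1 : G) 1, extChartAt 𝓘(ℝ, E) (1 : G) 1) :=
  contDiffAt_chart_of_contMDiffAt (by simp)
    ((contMDiffAt_chart_symm_fst _ rfl).mul (contMDiffAt_chart_symm_snd _ rfl))

theorem contDiffAt_chartConj :
    ContDiffAt ℝ ∞ (Function.uncurry (chartConj E G))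
      (extChartAt 𝓘(ℝ, E) (1 : G) 1, extChartAt 𝓘(ℝ, E) (1 : G) 1) :=
  contDiffAt_chart_of_contMDiffAt (by simp)
    (((contMDiffAt_chart_symm_fst _ rfl).mul (contMDiffAt_chart_symm_snd _ rfl)).mul
      (contMDiffAt_chart_symm_fst _ rfl).inv)

theorem inverse_mfderiv_extChartAt_symm {x₀ : G} {z : E}
    (hz : z ∈ (extChartAt 𝓘(ℝ, E) x₀).target) :
    (mfderiv 𝓘(ℝ, E) 𝓘(ℝ, E) (extChartAt 𝓘(ℝ, E) x₀).symm z).inverse =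
      mfderiv 𝓘(ℝ, E) 𝓘(ℝ, E) (extChartAt 𝓘(ℝ, E) x₀) ((extChartAt 𝓘(ℝ, E) x₀).symm z) := by
  have : IsManifold 𝓘(ℝ, E) 1 G := IsManifold.of_le (n := ∞) (by simp)
  have h1 := mfderivWithin_extChartAt_symm_comp_mfderiv_extChartAt hz
  have h2 := mfderiv_extChartAt_comp_mfderivWithin_extChartAt_symm hz
  rw [ModelWithCorners.range_eq_univ, mfderivWithin_univ] at h1 h2
  exact ContinuousLinearMap.inverse_eq h1 h2

/-- In the chart, left translation by the point with coordinate a is b ↦ F(a, b), where F is the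
local group law. The field is its derivative at the coordinate of 1. -/
theorem fieldInChart_mulInvariantVectorField {a : E}
    (ha : a ∈ (extChartAt 𝓘(ℝ, E) (1 : G)).target) (X : E) :
    fieldInChart (mulInvariantVectorField (I := 𝓘(ℝ, E)) (G := G) X) 1 a =
      fderiv ℝ (chartMul E G a) (extChartAt 𝓘(ℝ, E) (1 : G) 1) X := by
  let ψ := (extChartAt 𝓘(ℝ, E) (1 : G)).symm
  let p := extChartAt 𝓘(ℝ, E) (1 : G) 1
  have hψp : ψ p = 1 := extChartAt_to_inv 1
  have hψ := (contMDiffAt_extChartAt_symm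
    (mem_extChartAt_target (I := 𝓘(ℝ, E)) (1 : G))).mdifferentiableAt (by simp)
  have hL := mdifferentiableAt_mul_left (E := E) (ψ a) (ψ p)
  have hφ : MDifferentiableAt 𝓘(ℝ, E) 𝓘(ℝ, E) (extChartAt 𝓘(ℝ, E) (1 : G)) (ψ a * ψ p) := by
    rw [hψp, mul_one]
    refine (contMDiffAt_extChartAt' (n := ∞) ?_).mdifferentiableAt (by simp)
    have := (extChartAt 𝓘(ℝ, E) (1 : G)).map_target ha
    rwa [extChartAt_source] at this
  have e1 : mfderiv 𝓘(ℝ, E) 𝓘(ℝ, E) (fun b => ψ a * ψ b) p =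
      (leftDifferential (E := E) (ψ a) (ψ p)).comp (mfderiv 𝓘(ℝ, E) 𝓘(ℝ, E) ψ p) :=
    mfderiv_comp p hL hψ
  have e2 : mfderiv 𝓘(ℝ, E) 𝓘(ℝ, E) (chartMul E G a) p =
      (mfderiv 𝓘(ℝ, E) 𝓘(ℝ, E) (extChartAt 𝓘(ℝ, E) (1 : G)) (ψ a * ψ p)).comp
        (mfderiv 𝓘(ℝ, E) 𝓘(ℝ, E) (fun b => ψ a * ψ b) p) :=
    mfderiv_comp p hφ (hL.comp p hψ)
  have e3 : mfderiv 𝓘(ℝ, E) 𝓘(ℝ, E) ψ p = ContinuousLinearMap.id ℝ E :=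
    mfderiv_extChartAt_symm_self (1 : G)
  rw [mfderiv_eq_fderiv, e1, e3, hψp, mul_one] at e2
  rw [fieldInChart, inverse_mfderiv_extChartAt_symm ha]
  exact (DFunLike.congr_fun e2 X).symm

theorem mdifferentiable_conj (g x : G) :
    MDifferentiableAt 𝓘(ℝ, E) 𝓘(ℝ, E) (fun x : G => g * x * g⁻¹) x :=
  ((contMDiff_mul_right (n := ∞)).comp
    (contMDiff_mul_left (n := ∞))).contMDiffAt.mdifferentiableAt (by simp)

/-- Conjugation fixes 1, so the chart is centred at both ends and adds no factor. -/
theorem fderiv_chartConj (a : E) :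
    fderiv ℝ (chartConj E G a) (extChartAt 𝓘(ℝ, E) (1 : G) 1) =
      adjoint ((extChartAt 𝓘(ℝ, E) (1 : G)).symm a) := by
  let ψ := (extChartAt 𝓘(ℝ, E) (1 : G)).symm
  let p := extChartAt 𝓘(ℝ, E) (1 : G) 1
  have hψp : ψ p = 1 := extChartAt_to_inv 1
  have hψ := (contMDiffAt_extChartAt_symm
    (mem_extChartAt_target (I := 𝓘(ℝ, E)) (1 : G))).mdifferentiableAt (by simp)
  have hC := mdifferentiable_conj (E := E) (ψ a) (ψ p)
  have h1 : ψ a * ψ p * (ψ a)⁻¹ = 1 := by rw [hψp]; simp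
  have hφ : MDifferentiableAt 𝓘(ℝ, E) 𝓘(ℝ, E) (extChartAt 𝓘(ℝ, E) (1 : G))
      (ψ a * ψ p * (ψ a)⁻¹) := by
    rw [h1]
    exact (contMDiffAt_extChartAt (n := ∞)).mdifferentiableAt (by simp)
  have e1 : mfderiv 𝓘(ℝ, E) 𝓘(ℝ, E) (fun b => ψ a * ψ b * (ψ a)⁻¹) p =
      (mfderiv 𝓘(ℝ, E) 𝓘(ℝ, E) (fun x : G => ψ a * x * (ψ a)⁻¹) (ψ p)).comp
        (mfderiv 𝓘(ℝ, E) 𝓘(ℝ, E) ψ p) :=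
    mfderiv_comp p hC hψ
  have e2 : mfderiv 𝓘(ℝ, E) 𝓘(ℝ, E) (chartConj E G a) p =
      (mfderiv 𝓘(ℝ, E) 𝓘(ℝ, E) (extChartAt 𝓘(ℝ, E) (1 : G)) (ψ a * ψ p * (ψ a)⁻¹)).comp
        (mfderiv 𝓘(ℝ, E) 𝓘(ℝ, E) (fun b => ψ a * ψ b * (ψ a)⁻¹) p) :=
    mfderiv_comp p hφ (hC.comp p hψ)
  have e3 : mfderiv 𝓘(ℝ, E) 𝓘(ℝ, E) ψ p = ContinuousLinearMap.id ℝ E :=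
    mfderiv_extChartAt_symm_self (1 : G)
  rw [mfderiv_eq_fderiv, e1, e3, mfderiv_extChartAt_of_eq h1, hψp] at e2
  exact e2

/-- The derivative of the adjoint representation at the identity is the Lie bracket. -/
theorem hasFDerivAt_adjoint (Y : E) :
    ∃ D : E →L[ℝ] E, HasFDerivAt
      (fun a => adjoint (E := E) ((extChartAt 𝓘(ℝ, E) (1 : G)).symm a) Y) D
      (extChartAt 𝓘(ℝ, E) (1 : G) 1) ∧
      ∀ X : E, D X = VectorField.mlieBracket 𝓘(ℝ, E)
        (mulInvariantVectorField (I := 𝓘(ℝ, E)) (G := G) X) (mulInvariantVectorField Y) 1 := by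
  let φ := extChartAt 𝓘(ℝ, E) (1 : G)
  let p := φ 1
  have hψp : φ.symm p = 1 := extChartAt_to_inv 1
  have htarget : ∀ᶠ a in 𝓝 p, a ∈ φ.target := extChartAt_target_mem_nhds (1 : G)
  have hsource : ∀ {f : E × E → G}, ContinuousAt f (p, p) → f (p, p) = 1 →
      ∀ᶠ q in 𝓝 (p, p), f q ∈ φ.source := by
    intro f hf h1
    refine hf.preimage_mem_nhds ?_
    rw [h1]
    exact extChartAt_source_mem_nhds (1 : G)
  have hmul : DifferentiableAt ℝ (fun a => fderiv ℝ (chartMul E G a) p) p :=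
    (ContDiffAt.fderiv (m := ∞) contDiffAt_chartMul contDiffAt_const
      (by simp)).differentiableAt (by simp)
  have hconj : DifferentiableAt ℝ (fun a => fderiv ℝ (chartConj E G a) p) p :=
    (ContDiffAt.fderiv (m := ∞) contDiffAt_chartConj contDiffAt_const
      (by simp)).differentiableAt (by simp)
  have hcomm := fderiv_conj_eq_commutator (F := chartMul E G) (c := chartConj E G) (p := p)
    contDiffAt_chartMul contDiffAt_chartConj
    (by
      filter_upwards [htarget] with x hx
      change φ (φ.symm x * φ.symm p) = x
      rw [hψp, mul_one, φ.right_inv hx])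
    (Filter.Eventually.of_forall fun a => by
      change φ (φ.symm a * φ.symm p * (φ.symm a)⁻¹) = φ 1
      rw [hψp]; simp)
    (by
      filter_upwards [htarget] with x hx
      change φ (φ.symm p * φ.symm x * (φ.symm p)⁻¹) = x
      rw [hψp, one_mul, inv_one, mul_one, φ.right_inv hx])
    (by
      have hc : ContinuousAt
          (fun q : E × E => φ.symm q.1 * φ.symm q.2 * (φ.symm q.1)⁻¹) (p, p) :=
        (((contMDiffAt_chart_symm_fst (p, p) rfl).mul
          (contMDiffAt_chart_symm_snd (p, p) rfl)).mul
          (contMDiffAt_chart_symm_fst (p, p) rfl).inv).continuousAt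
      filter_upwards [hsource hc (by simp [hψp])] with q hq
      change φ (φ.symm (φ (φ.symm q.1 * φ.symm q.2 * (φ.symm q.1)⁻¹)) * φ.symm q.1) =
        φ (φ.symm q.1 * φ.symm q.2)
      rw [φ.left_inv hq, inv_mul_cancel_right])
  -- The derivative of a left-invariant field in the chart is a second derivative of the local group
  -- law; the bracket of two such fields is therefore the commutator in `hcomm`.
  have hfield : ∀ X Z : E, fderiv ℝ
      (fieldInChart (mulInvariantVectorField (I := 𝓘(ℝ, E)) (G := G) X) 1) p Z =
        fderiv ℝ (fun a => fderiv ℝ (chartMul E G a) p) p Z X := by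
    intro X Z
    have e : fieldInChart (mulInvariantVectorField (I := 𝓘(ℝ, E)) (G := G) X) 1 =ᶠ[𝓝 p]
        fun a => fderiv ℝ (chartMul E G a) p X := by
      filter_upwards [htarget] with a ha
      exact fieldInChart_mulInvariantVectorField ha X
    rw [e.fderiv_eq, (hmul.hasFDerivAt.clm_apply (hasFDerivAt_const X p)).fderiv]
    simp
  have hone : ∀ X : E, (mulInvariantVectorField (I := 𝓘(ℝ, E)) (G := G) X 1 : E) = X :=
    fun X => DFunLike.congr_fun (leftDifferential_one (1 : G)) X
  refine ⟨_, (hconj.hasFDerivAt.clm_apply (hasFDerivAt_const Y p)).congr_of_eventuallyEq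
    (Filter.Eventually.of_forall fun a => (DFunLike.congr_fun (fderiv_chartConj a) Y).symm), fun X => ?_⟩
  refine Eq.trans ?_ (mlieBracket_eq_fderiv _ _ _).symm
  refine Eq.trans ?_ (congrArg₂ (· - ·) (hfield Y _) (hfield X _)).symm
  rw [hone, hone]
  refine Eq.trans ?_ (hcomm X Y)
  simp

end Adjoint

/-! ### From the nilpotent group to the nilpotent Lie algebra -/

section Nilpotent

variable {E : Type*} [NormedAddCommGroup E] [NormedSpace ℝ E]
  {G : Type*} [TopologicalSpace G] [ChartedSpace E G] [Group G]

variable (E G) in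
/-- The ascending filtration of the Lie algebra defined by the adjoint representation. -/
def adjointFiltration : ℕ → Submodule ℝ E
  | 0 => ⊥
  | k + 1 => ⨅ g : G, (adjointFiltration k).comap
      ((adjoint (E := E) g - ContinuousLinearMap.id ℝ E : E →L[ℝ] E) : E →ₗ[ℝ] E)

theorem mem_adjointFiltration_succ {k : ℕ} {Y : E} :
    Y ∈ adjointFiltration E G (k + 1) ↔ ∀ g : G, adjoint g Y - Y ∈ adjointFiltration E G k := by
  simp [adjointFiltration]

variable (E) in
/-- The differential at the identity, in the model space. -/
def differentialAtOne (f : G → G) : E →L[ℝ] E := mfderiv 𝓘(ℝ, E) 𝓘(ℝ, E) f 1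

variable [LieGroup 𝓘(ℝ, E) ∞ G]

/-- The differential of multiplication at (1, 1) is addition. -/
theorem differentialAtOne_mul {f h : G → G} (hf : MDifferentiableAt 𝓘(ℝ, E) 𝓘(ℝ, E) f 1)
    (hh : MDifferentiableAt 𝓘(ℝ, E) 𝓘(ℝ, E) h 1) (hf1 : f 1 = 1) (hh1 : h 1 = 1) (v : E) :
    differentialAtOne E (fun x => f x * h x) v =
      differentialAtOne E f v + differentialAtOne E h v := by
  have hm : MDifferentiableAt (𝓘(ℝ, E).prod 𝓘(ℝ, E)) 𝓘(ℝ, E) (fun q : G × G => q.1 * q.2)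
      (f 1, h 1) :=
    (contMDiff_mul 𝓘(ℝ, E) ∞).contMDiffAt.mdifferentiableAt (by simp)
  have e1 : mfderiv 𝓘(ℝ, E) 𝓘(ℝ, E) (fun x => f x * h x) 1 = _ :=
    mfderiv_comp (1 : G) hm (hf.prodMk hh)
  rw [differentialAtOne, e1, mfderiv_prodMk hf hh]
  refine (mfderiv_prod_eq_add_apply hm).trans ?_
  have e2 : (fun z : G => z * h 1) = id := by ext; simp [hh1]
  have e3 : (fun z : G => f 1 * z) = id := by ext; simp [hf1]
  simp only
  rw [e2, e3, mfderiv_id, mfderiv_id]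
  rfl

/-- Maps into the ascending central series differentiate into the adjoint filtration. -/
theorem differentialAtOne_mem_adjointFiltration (k : ℕ) (f : G → G)
    (hf : MDifferentiableAt 𝓘(ℝ, E) 𝓘(ℝ, E) f 1) (hf1 : f 1 = 1)
    (hfk : ∀ x, f x ∈ Subgroup.upperCentralSeries G k) (v : E) :
    differentialAtOne E f v ∈ adjointFiltration E G k := by
  induction k generalizing f with
  | zero =>
    have hf' : f = fun _ => 1 := by
      ext x
      simpa using hfk x
    rw [hf', differentialAtOne, mfderiv_const]
    exact zero_mem _
  | succ k ih =>
    rw [mem_adjointFiltration_succ]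
    intro g
    have hconj : MDifferentiableAt 𝓘(ℝ, E) 𝓘(ℝ, E) (fun x => g * f x * g⁻¹) 1 :=
      (mdifferentiable_conj g (f 1)).comp 1 hf
    have hinv : MDifferentiableAt 𝓘(ℝ, E) 𝓘(ℝ, E) (fun x => (f x)⁻¹) 1 :=
      ((contMDiff_inv 𝓘(ℝ, E) ∞).contMDiffAt.mdifferentiableAt (by simp)).comp 1 hf
    -- For f with values in the (k+1)-st term of the upper central series, this commutator takes
    -- values in the k-th. As h·f is the conjugate of f by g, its differential is Ad(g)df - df.
    let h : G → G := fun x => g * f x * g⁻¹ * (f x)⁻¹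
    have hh : MDifferentiableAt 𝓘(ℝ, E) 𝓘(ℝ, E) h 1 :=
      ((contMDiff_mul 𝓘(ℝ, E) ∞).contMDiffAt.mdifferentiableAt
        (by simp)).comp 1 (hconj.prodMk hinv)
    have hh1 : h 1 = 1 := by simp [h, hf1]
    have hhk : ∀ x, h x ∈ Subgroup.upperCentralSeries G k := by
      intro x
      have := hfk x
      rw [Subgroup.mem_upperCentralSeries_succ_iff] at this
      have := inv_mem (this g)
      simpa [h, commutatorElement_def, mul_assoc] using this
    have key := differentialAtOne_mul hh hf hh1 hf1 v
    have e1 : (fun x => h x * f x) = fun x => g * f x * g⁻¹ := by ext x; simp [h]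
    have e2 : differentialAtOne E (fun x => g * f x * g⁻¹) v =
        adjoint g (differentialAtOne E f v) := by
      have e3 : mfderiv 𝓘(ℝ, E) 𝓘(ℝ, E) (fun x => g * f x * g⁻¹) 1 = _ :=
        mfderiv_comp (1 : G) (mdifferentiable_conj g (f 1)) hf
      rw [differentialAtOne, e3, hf1]
      rfl
    rw [e1, e2] at key
    rw [key, add_sub_cancel_right]
    exact ih h hh hh1 hhk

/-- The identity map takes values in the top term of the upper central series, and its differential
is onto. -/
theorem exists_adjointFiltration_eq_top [Group.IsNilpotent G] :
    ∃ c, adjointFiltration E G c = ⊤ := by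
  obtain ⟨c, hc⟩ := Group.IsNilpotent.nilpotent G
  refine ⟨c, eq_top_iff.2 fun v _ => ?_⟩
  have := differentialAtOne_mem_adjointFiltration c (id : G → G) mdifferentiableAt_id rfl
    (fun x => by rw [hc]; exact Subgroup.mem_top _) v
  rwa [differentialAtOne, mfderiv_id] at this

variable [FiniteDimensional ℝ E]

/-- If a functional l vanishes on W_k and Y ∈ W_{k+1}, then l(Ad(g)Y) = l(Y) for all g. Its
derivative at 1, which is l([X, Y]), is therefore zero. -/
theorem mlieBracket_mem_adjointFiltration (k : ℕ) (X Y : E)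
    (hY : Y ∈ adjointFiltration E G (k + 1)) :
    (VectorField.mlieBracket 𝓘(ℝ, E) (mulInvariantVectorField (I := 𝓘(ℝ, E)) (G := G) X)
      (mulInvariantVectorField Y) 1 : E) ∈ adjointFiltration E G k := by
  obtain ⟨D, hD, hDX⟩ := hasFDerivAt_adjoint (G := G) Y
  by_contra hnot
  rw [← hDX X] at hnot
  obtain ⟨l, hl, hlk⟩ := Submodule.exists_le_ker_of_notMem (V := E) hnot
  let l' : E →L[ℝ] ℝ := LinearMap.toContinuousLinearMap l
  have h1 := l'.hasFDerivAt.comp _ hD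
  have h2 : HasFDerivAt (l' ∘ fun a => adjoint (E := E)
      ((extChartAt 𝓘(ℝ, E) (1 : G)).symm a) Y) (0 : E →L[ℝ] ℝ)
      (extChartAt 𝓘(ℝ, E) (1 : G) 1) := by
    refine (hasFDerivAt_const (l Y) _).congr_of_eventuallyEq (Filter.Eventually.of_forall ?_)
    intro a
    have h3 : l (adjoint (E := E) ((extChartAt 𝓘(ℝ, E) (1 : G)).symm a) Y - Y) = 0 :=
      hlk (mem_adjointFiltration_succ.1 hY _)
    rw [map_sub, sub_eq_zero] at h3
    exact h3
  exact hl (DFunLike.congr_fun (h1.unique h2) X)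

omit [FiniteDimensional ℝ E] in
theorem lieGroup_minSmoothness : LieGroup 𝓘(ℝ, E) (minSmoothness ℝ 3) G :=
  LieGroup.of_le (n := ∞) (by
    rw [minSmoothness_of_isRCLikeNormedField]
    exact ENat.LEInfty.out)

variable (E G) in
/-- The Lie bracket of a Lie group, in the model space. -/
def bracket : E →ₗ[ℝ] E →ₗ[ℝ] E :=
  have : LieGroup 𝓘(ℝ, E) (minSmoothness ℝ 3) G := lieGroup_minSmoothness
  LinearMap.mk₂ ℝ (fun X Y : E => (VectorField.mlieBracket 𝓘(ℝ, E)
      (mulInvariantVectorField (I := 𝓘(ℝ, E)) (G := G) X) (mulInvariantVectorField Y) 1 : E))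
    (add_lie (L := GroupLieAlgebra 𝓘(ℝ, E) G) (M := GroupLieAlgebra 𝓘(ℝ, E) G))
    (smul_lie (L := GroupLieAlgebra 𝓘(ℝ, E) G) (M := GroupLieAlgebra 𝓘(ℝ, E) G))
    (lie_add (L := GroupLieAlgebra 𝓘(ℝ, E) G) (M := GroupLieAlgebra 𝓘(ℝ, E) G))
    (lie_smul (L := GroupLieAlgebra 𝓘(ℝ, E) G) (M := GroupLieAlgebra 𝓘(ℝ, E) G))

theorem bracket_apply (X Y : E) : bracket E G X Y =
    VectorField.mlieBracket 𝓘(ℝ, E) (mulInvariantVectorField (I := 𝓘(ℝ, E)) (G := G) X)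
      (mulInvariantVectorField Y) 1 := rfl

theorem bracket_anti (X Y : E) : bracket E G X Y = -bracket E G Y X := by
  rw [bracket_apply, VectorField.mlieBracket_swap_apply]
  rfl

end Nilpotent

/-! ### Smoothness of left-invariant vector fields -/

section SalamonBasis

variable {E : Type*} [NormedAddCommGroup E] [NormedSpace ℝ E]
  {G : Type*} [TopologicalSpace G] [ChartedSpace E G] [Group G] {n : ℕ}

theorem toDForm_mem_typeP0_iff {M : Type*} [TopologicalSpace M] [ChartedSpace E M]
    {J : EndField E M} {α : OneForm E M} {x : M} :
    α.toDForm x ∈ typeP0 J 1 x ↔ ∀ v, α x (J x v) = Complex.I * α x v := by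
  constructor
  · intro h v
    simpa [OneForm.toDForm] using h (fun _ => v) 0
  · intro h v i
    obtain rfl : i = 0 := Subsingleton.elim _ _
    simpa [OneForm.toDForm] using h (v 0)

variable [LieGroup 𝓘(ℝ, E) ∞ G]

/-- The field is the tangent map of the multiplication applied to (0, v) at (g, 1), a composition of
smooth maps. -/
theorem contMDiff_mulInvariantVectorField_infty (v : E) :
    ContMDiff 𝓘(ℝ, E) 𝓘(ℝ, E).tangent ∞ (fun g : G =>
      (⟨g, mulInvariantVectorField (I := 𝓘(ℝ, E)) (G := G) v g⟩ : TangentBundle 𝓘(ℝ, E) G)) := by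
  let fg : G → TangentBundle 𝓘(ℝ, E) G := fun g => Bundle.TotalSpace.mk' E g 0
  have sfg : ContMDiff 𝓘(ℝ, E) 𝓘(ℝ, E).tangent ∞ fg := Bundle.contMDiff_zeroSection _ _
  let fv : G → TangentBundle 𝓘(ℝ, E) G := fun _ => Bundle.TotalSpace.mk' E 1 v
  have sfv : ContMDiff 𝓘(ℝ, E) 𝓘(ℝ, E).tangent ∞ fv := contMDiff_const
  have S₁ := sfg.prodMk sfv
  have S₂ : ContMDiff (𝓘(ℝ, E).tangent.prod 𝓘(ℝ, E).tangent) (𝓘(ℝ, E).prod 𝓘(ℝ, E)).tangent ∞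
      (equivTangentBundleProd 𝓘(ℝ, E) G 𝓘(ℝ, E) G).symm := contMDiff_equivTangentBundleProd_symm
  have S₃ : ContMDiff (𝓘(ℝ, E).prod 𝓘(ℝ, E)).tangent 𝓘(ℝ, E).tangent ∞
      (tangentMap (𝓘(ℝ, E).prod 𝓘(ℝ, E)) 𝓘(ℝ, E) fun p : G × G => p.1 * p.2) :=
    (contMDiff_mul 𝓘(ℝ, E) ∞).contMDiff_tangentMap (by simp)
  have S := (S₃.comp S₂).comp S₁
  have e : ∀ g : G, (⟨g, mulInvariantVectorField (I := 𝓘(ℝ, E)) (G := G) v g⟩ :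
      TangentBundle 𝓘(ℝ, E) G) = tangentMap (𝓘(ℝ, E).prod 𝓘(ℝ, E)) 𝓘(ℝ, E)
      (fun p : G × G => p.1 * p.2) ⟨(g, 1), ((0 : E), v)⟩ := by
    intro g
    have h1 : mfderiv (𝓘(ℝ, E).prod 𝓘(ℝ, E)) 𝓘(ℝ, E) (fun p : G × G => p.1 * p.2) (g, 1)
        ((0 : E), v) = leftDifferential g 1 v := by
      refine (mfderiv_prod_eq_add_apply ((contMDiff_mul 𝓘(ℝ, E) ∞).mdifferentiableAt
        (by simp))).trans ?_
      refine (congrArg₂ (· + ·) (map_zero _) rfl).trans ?_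
      exact zero_add _
    rw [tangentMap, h1]
    congr 1
    simp
  exact S.congr e

end SalamonBasis

/-! ### Existence of Salamon bases -/

section SalamonBasis

variable {E : Type*} [NormedAddCommGroup E] [NormedSpace ℝ E] [FiniteDimensional ℝ E]
  {G : Type*} [TopologicalSpace G] [ChartedSpace E G] [Group G] [LieGroup 𝓘(ℝ, E) ∞ G]

theorem bracket_mulInvariantVectorField (X Y : E) (g : G) :
    (VectorField.mlieBracket 𝓘(ℝ, E) (mulInvariantVectorField (I := 𝓘(ℝ, E)) (G := G) X)
      (mulInvariantVectorField Y) g : E) = leftDifferential g 1 (bracket E G X Y) := by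
  have : LieGroup 𝓘(ℝ, E) (minSmoothness ℝ 3) G := lieGroup_minSmoothness
  exact (congrFun (mulInvariantVector_mlieBracket (I := 𝓘(ℝ, E)) (G := G) X Y) g).symm

/-- Cartan's formula for left-invariant forms on left-invariant vectors. -/
theorem d_apply_leftDifferential {α : G → E →L[ℝ] ℂ}
    (hα : (OneForm.toDForm (E := E) α).IsLeftInvariant) (g : G) (X Y : E) :
    (OneForm.toDForm (E := E) α).d g
      (![leftDifferential g 1 X, leftDifferential g 1 Y] : Fin 2 → E) =
        -α 1 (bracket E G X Y) := by
  have hsm (Z : E) := (contMDiff_mulInvariantVectorField_infty (G := G) Z).mdifferentiableAt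
    (x := g) (by simp)
  refine (OneForm.d_apply_of_const (isSmoothOn_of_isLeftInvariant hα) (hsm X) (hsm Y)
    (fun y => apply_leftDifferential_one hα y X)
    (fun y => apply_leftDifferential_one hα y Y)).trans ?_
  refine congrArg Neg.neg ?_
  refine (congrArg (α g) (bracket_mulInvariantVectorField X Y g)).trans ?_
  exact apply_leftDifferential_one hα g _

variable {J : G → E →L[ℝ] E}

omit [FiniteDimensional ℝ E] [LieGroup 𝓘(ℝ, E) ∞ G] in
theorem apply_leftDifferential_of_isLeftInvariantEnd (hJinv : IsLeftInvariantEnd (E := E) J) (g : G)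
    (v : E) : J g (leftDifferential g 1 v) = leftDifferential g 1 (J 1 v) := by
  have h : J (g * 1) (leftDifferential g 1 v) = leftDifferential g 1 (J 1 v) := hJinv g 1 v
  rwa [mul_one] at h

/-- The integrability condition at 1 for left-invariant fields: J maps the field of Z to the field
of J_1 Z. -/
theorem bracket_nijenhuis (hJ : IsComplexStructure (E := E) J)
    (hJinv : IsLeftInvariantEnd (E := E) J) (X Y : E) :
    bracket E G (J 1 X) (J 1 Y) =
      bracket E G X Y + J 1 (bracket E G (J 1 X) Y) + J 1 (bracket E G X (J 1 Y)) := by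
  have h (V W : G → E) (hV : V = fun g => J g (leftDifferential g 1 X))
      (hW : W = fun g => J g (leftDifferential g 1 Y)) :
      (VectorField.mlieBracket 𝓘(ℝ, E) V W 1 : E) = bracket E G X Y
        + J 1 (VectorField.mlieBracket 𝓘(ℝ, E) V (mulInvariantVectorField Y) 1 : E)
        + J 1 (VectorField.mlieBracket 𝓘(ℝ, E) (mulInvariantVectorField X) W 1 : E) := by
    subst hV hW
    exact hJ.integrable _ _ (contMDiff_mulInvariantVectorField_infty X)
      (contMDiff_mulInvariantVectorField_infty Y) 1
  have e (Z : E) : (mulInvariantVectorField (I := 𝓘(ℝ, E)) (G := G) (J 1 Z)) =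
      fun g => J g (leftDifferential g 1 Z) :=
    funext fun g => (apply_leftDifferential_of_isLeftInvariantEnd hJinv g Z).symm
  exact h _ _ (e X) (e Y)

theorem exists_isSalamonBasis [Group.IsNilpotent G] {n : ℕ} (hn : Module.finrank ℝ E = 2 * n)
    (hJ : IsComplexStructure (E := E) J) (hJinv : IsLeftInvariantEnd (E := E) J) :
    ∃ θ : Fin n → OneForm E G, IsSalamonBasis (E := E) J θ := by
  obtain ⟨c, hc⟩ := exists_adjointFiltration_eq_top (E := E) (G := G)
  obtain ⟨θ, hθ, hθJ, η, hη⟩ := exists_triangular_one_zero_forms hn (bracket E G) bracket_anti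
    (W := adjointFiltration E G) rfl hc
    (fun k x y hy => mlieBracket_mem_adjointFiltration k x y hy) (J 1 : E →ₗ[ℝ] E)
    (hJ.sq 1) (bracket_nijenhuis hJ hJinv)
  let Θ (i : Fin n) : G → E →L[ℝ] ℂ := leftInvariantForm (LinearMap.toContinuousLinearMap (θ i))
  let H (i j : Fin n) : G → E →L[ℝ] ℂ :=
    leftInvariantForm (LinearMap.toContinuousLinearMap (η i j))
  have hΘ (i) : (OneForm.toDForm (E := E) (Θ i)).IsLeftInvariant :=
    leftInvariantForm_isLeftInvariant _
  have hH (i j) : (OneForm.toDForm (E := E) (H i j)).IsLeftInvariant :=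
    leftInvariantForm_isLeftInvariant _
  have hΘ1 (i g v) : Θ i g (leftDifferential g 1 v) = θ i v :=
    (apply_leftDifferential_one (hΘ i) g v).trans (leftInvariantForm_one _ v)
  have hH1 (i j g v) : H i j g (leftDifferential g 1 v) = η i j v :=
    (apply_leftDifferential_one (hH i j) g v).trans (leftInvariantForm_one _ v)
  refine ⟨Θ, hΘ, fun i g => toDForm_mem_typeP0_iff.2 fun v => ?_, fun g => ?_,
    H, fun i j _ => isSmoothOn_of_isLeftInvariant (hH i j), fun i g => ?_⟩
  · obtain ⟨w, rfl⟩ := leftDifferential_surjective (E := E) g v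
    refine (congrArg (Θ i g) (apply_leftDifferential_of_isLeftInvariantEnd hJinv g w)).trans ?_
    rw [hΘ1]
    exact (hθJ i w).trans (congrArg _ (hΘ1 i g w).symm)
  · rw [Fintype.linearIndependent_iff] at hθ
    refine Fintype.linearIndependent_iff.2 fun a ha => ?_
    refine hθ a (LinearMap.ext fun v => ?_)
    have ha' : ∑ i, a i • (Θ i g : E →L[ℝ] ℂ) = 0 := ha
    have := DFunLike.congr_fun ha' (leftDifferential g 1 v)
    simpa [hΘ1] using this
  · ext v
    -- Left-translated vectors exhaust the tangent space at g, so the structure equation need only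
    -- be checked on them, where it is the algebraic identity at 1.
    obtain ⟨X, hX⟩ := leftDifferential_surjective (E := E) g (v 0)
    obtain ⟨Y, hY⟩ := leftDifferential_surjective (E := E) g (v 1)
    obtain rfl : v = (![leftDifferential g 1 X, leftDifferential g 1 Y] : Fin 2 → E) := by
      ext k
      fin_cases k
      · exact hX.symm
      · exact hY.symm
    refine (d_apply_leftDifferential (hΘ i) g X Y).trans ?_
    refine (congrArg Neg.neg (leftInvariantForm_one _ _)).trans ((hη i X Y).trans ?_)
    change _ = (∑ j ∈ Finset.Iio i, (wedge ![H i j g, Θ j g] : E [⋀^Fin 2]→L[ℝ] ℂ))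
      (![leftDifferential g 1 X, leftDifferential g 1 Y] : Fin 2 → E)
    rw [ContinuousAlternatingMap.sum_apply]
    refine Finset.sum_congr rfl fun j _ => ?_
    refine Eq.trans ?_ (wedge_pair_apply (H i j g) (Θ j g) (leftDifferential g 1 X)
      (leftDifferential g 1 Y)).symm
    simp only [hΘ1, hH1]

end SalamonBasis

/-! ### The volume form of a Salamon basis -/

section SalamonWedge

variable {E : Type*} [NormedAddCommGroup E] [NormedSpace ℝ E]
  {G : Type*} [TopologicalSpace G] [ChartedSpace E G] [Group G]
  {n : ℕ} {J : EndField E G} {θ : Fin n → OneForm E G}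

theorem IsSalamonBasis.wedge_isLeftInvariant (h : IsSalamonBasis J θ) :
    DForm.IsLeftInvariant (E := E) (fun x => wedge fun i => θ i x) := by
  intro g x
  refine (wedge_compContinuousLinearMap _ _).trans (congrArg wedge (funext fun i => ?_))
  ext v
  exact (isLeftInvariant_toDForm_iff (E := E) (θ i)).1 (h.leftInvariant i) g x v

theorem IsSalamonBasis.wedge_ne_zero (h : IsSalamonBasis J θ) (x : G) :
    wedge (fun i => θ i x) ≠ 0 :=
  wedge_ne_zero_of_linearIndependent (V := E) (h.linearIndependent x)

theorem IsSalamonBasis.wedge_mem_typeP0 (h : IsSalamonBasis J θ) (x : G) :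
    wedge (fun i => θ i x) ∈ typeP0 J n x := fun v j =>
  wedge_update_of_one_zero (V := E) (J := J x)
    (fun i => toDForm_mem_typeP0_iff.1 (h.type i x)) v j

variable [LieGroup 𝓘(ℝ, E) ∞ G]

theorem IsSalamonBasis.isSmoothOn (h : IsSalamonBasis J θ) (i : Fin n) :
    (θ i).toDForm.IsSmoothOn Set.univ :=
  isSmoothOn_of_isLeftInvariant (h.leftInvariant i)

theorem IsSalamonBasis.wedge_isSmoothOn (h : IsSalamonBasis J θ) :
    DForm.IsSmoothOn (E := E) (fun x => wedge fun i => θ i x) Set.univ := by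
  intro x₀
  rw [wedge_inChart]
  exact contDiffOn_wedge fun i => (OneForm.toDForm_isSmoothOn_iff _ _).1 (h.isSmoothOn i) x₀

variable [FiniteDimensional ℝ E]

/-- Closedness is checked in the chart at x; the η^i_j enter only through their values at x. -/
theorem IsSalamonBasis.wedge_d (h : IsSalamonBasis J θ) (x : G) :
    DForm.d (E := E) (fun x => wedge fun i => θ i x) x = 0 := by
  obtain ⟨η, -, hη⟩ := h.structureEquation
  refine ContinuousAlternatingMap.ext fun v => (DForm.d_apply (E := E) _ x v).trans ?_
  rw [wedge_inChart]
  refine DFunLike.congr_fun (extDeriv_wedge_eq_zero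
    (fun i => OneForm.differentiableAt_inChart (h.isSmoothOn i) x) (fun i j => η i j x)
    fun i a b => ?_) v
  refine (OneForm.d_toDForm_apply (h.isSmoothOn i) x (![a, b] : Fin 2 → E)).symm.trans ?_
  refine (DFunLike.congr_fun (hη i x) (![a, b] : Fin 2 → E)).trans ?_
  change (∑ j ∈ Finset.Iio i, (wedge ![η i j x, θ j x] : E [⋀^Fin 2]→L[ℝ] ℂ))
      (![a, b] : Fin 2 → E) = _
  rw [ContinuousAlternatingMap.sum_apply]
  refine Finset.sum_congr rfl fun j _ => ?_
  refine (wedge_pair_apply (V := E) (η i j x) (θ j x) a b).trans ?_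
  rw [OneForm.inChart_self, OneForm.inChart_self]
  rfl

theorem IsSalamonBasis.wedge_isHolomorphicOn (h : IsSalamonBasis J θ) :
    DForm.IsHolomorphicOn (E := E) J (fun x => wedge fun i => θ i x) Set.univ where
  smooth := h.wedge_isSmoothOn
  type x _ := h.wedge_mem_typeP0 x
  dbar x _ := by
    rw [h.wedge_d]
    exact zero_mem _

end SalamonWedge

/-! ### Local sections of the projection to the quotient -/

section Quotient

variable {E : Type*} [NormedAddCommGroup E] [NormedSpace ℝ E] [FiniteDimensional ℝ E]
  {G : Type*} [TopologicalSpace G] [ChartedSpace E G] [Group G] [LieGroup 𝓘(ℝ, E) ∞ G]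
  [T2Space G] (Γ : Subgroup G)

omit [TopologicalSpace G] [T2Space G] in
theorem proj_eq_iff {g h : G} : proj Γ g = proj Γ h ↔ g * h⁻¹ ∈ Γ := by
  rw [proj, proj, Quotient.eq, MulAction.orbitRel_apply]
  constructor
  · rintro ⟨γ, rfl⟩
    simp [Subgroup.smul_def]
  · intro hg
    exact ⟨⟨_, hg⟩, by simp [Subgroup.smul_def]⟩

/-- The representative of an orbit at which its chart is centred. -/
def representative (y : LeftQuotient Γ) : G :=
  -- The same choice as in the charts of the quotient, so that `chartAt_leftQuotient` holds by
  -- `rfl`. It need not be the `Quotient.out` of `inducedStructure`.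
  (Quotient.mk_surjective (s := MulAction.orbitRel Γ G)).hasRightInverse.choose y

omit [TopologicalSpace G] [T2Space G] in
theorem proj_representative (y : LeftQuotient Γ) : proj Γ (representative Γ y) = y :=
  (Quotient.mk_surjective (s := MulAction.orbitRel Γ G)).hasRightInverse.choose_spec y

variable [DiscreteTopology Γ]

variable (E) in
include E in
-- A discrete subgroup acts properly discontinuously by left translations, so the projection is a
-- covering.
theorem isLocalHomeomorph_proj : IsLocalHomeomorph (proj Γ) := by
  have : IsTopologicalGroup G := topologicalGroup_of_lieGroup 𝓘(ℝ, E) ∞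
  have : LocallyCompactSpace G := Manifold.locallyCompact_of_finiteDimensional 𝓘(ℝ, E)
  have : ProperlyDiscontinuousSMul Γ G :=
    Γ.properlyDiscontinuousSMul_of_tendsto_cofinite
      (Γ.tendsto_coe_cofinite_of_discrete (isDiscrete_iff_discreteTopology.mpr inferInstance))
  exact isQuotientCoveringMap_quotientMk_of_properlyDiscontinuousSMul.isCoveringMap
    |>.isLocalHomeomorph

variable (E) in
/-- The local inverse of the projection used for the chart at a point of the quotient. -/
def localSection (y : LeftQuotient Γ) : OpenPartialHomeomorph (LeftQuotient Γ) G :=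
  (isLocalHomeomorph_proj E Γ).localInverseAt (representative Γ y)

theorem chartAt_leftQuotient (y : LeftQuotient Γ) :
    chartAt E y = (localSection E Γ y).trans (chartAt E (representative Γ y)) := rfl

theorem atlas_leftQuotient : atlas E (LeftQuotient Γ) = Set.range (chartAt E) := rfl

theorem localSection_symm (y : LeftQuotient Γ) : ⇑(localSection E Γ y).symm = proj Γ :=
  (isLocalHomeomorph_proj E Γ).localInverseAt_symm _

theorem mem_localSection_source (y : LeftQuotient Γ) : y ∈ (localSection E Γ y).source := by
  have := (isLocalHomeomorph_proj E Γ).apply_self_mem_localInverseAt_source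
    (x := representative Γ y)
  rwa [proj_representative] at this

theorem localSection_self (y : LeftQuotient Γ) : localSection E Γ y y = representative Γ y := by
  have := (isLocalHomeomorph_proj E Γ).localInverseAt_apply_self (x := representative Γ y)
  rwa [proj_representative] at this

theorem proj_localSection {y x : LeftQuotient Γ} (hx : x ∈ (localSection E Γ y).source) :
    proj Γ (localSection E Γ y x) = x :=
  (isLocalHomeomorph_proj E Γ).apply_localInverseAt_of_mem hx

/-- Locally, a section after the projection is a left translation. -/
theorem localSection_proj_eventuallyEq {y : LeftQuotient Γ} {g : G}
    (hg : proj Γ g ∈ (localSection E Γ y).source) :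
    (fun h => localSection E Γ y (proj Γ h)) =ᶠ[𝓝 g]
      fun h => localSection E Γ y (proj Γ g) * g⁻¹ * h := by
  have : IsTopologicalGroup G := topologicalGroup_of_lieGroup 𝓘(ℝ, E) ∞
  set s := localSection E Γ y with hs
  have h1 : ∀ᶠ h in 𝓝 g, proj Γ h ∈ s.source :=
    (isLocalHomeomorph_proj E Γ).continuous.continuousAt (s.open_source.mem_nhds hg)
  have h2 : ∀ᶠ h in 𝓝 g, s (proj Γ g) * g⁻¹ * h ∈ s.target := by
    refine (continuous_const_mul (s (proj Γ g) * g⁻¹)).continuousAt (s.open_target.mem_nhds ?_)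
    simpa using s.map_source hg
  filter_upwards [h1, h2] with h hh1 hh2
  -- Both points lie in the target of the section, where the projection is injective, and they
  -- differ by an element of Γ.
  refine s.symm.injOn (s.map_source hh1) hh2 ?_
  rw [s.left_inv hh1, hs, localSection_symm, proj_eq_iff]
  have := (proj_eq_iff Γ).1 (proj_localSection Γ hg).symm
  simpa [mul_assoc] using this

end Quotient

/-! ### The smooth structure of the quotient -/

section QuotientManifold

variable {E : Type*} [NormedAddCommGroup E] [NormedSpace ℝ E] [FiniteDimensional ℝ E]
  {G : Type*} [TopologicalSpace G] [ChartedSpace E G] [Group G] [LieGroup 𝓘(ℝ, E) ∞ G]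
  [T2Space G] (Γ : Subgroup G) [DiscreteTopology Γ]

theorem extChartAt_leftQuotient_symm (y : LeftQuotient Γ) :
    ⇑(extChartAt 𝓘(ℝ, E) y).symm =
      proj Γ ∘ (extChartAt 𝓘(ℝ, E) (representative Γ y)).symm := by
  rw [← localSection_symm (E := E) Γ y]
  rfl

theorem extChartAt_leftQuotient (y : LeftQuotient Γ) :
    ⇑(extChartAt 𝓘(ℝ, E) y) =
      extChartAt 𝓘(ℝ, E) (representative Γ y) ∘ localSection E Γ y := rfl

theorem extChartAt_leftQuotient_target_subset (y : LeftQuotient Γ) :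
    (extChartAt 𝓘(ℝ, E) y).target ⊆ (extChartAt 𝓘(ℝ, E) (representative Γ y)).target := by
  intro z hz
  rw [extChartAt_target] at hz ⊢
  exact ⟨hz.1.1, hz.2⟩

theorem extChartAt_leftQuotient_self (y : LeftQuotient Γ) :
    extChartAt 𝓘(ℝ, E) y y = extChartAt 𝓘(ℝ, E) (representative Γ y) (representative Γ y) := by
  rw [extChartAt_leftQuotient, Function.comp_apply, localSection_self]

theorem extChartAt_proj_eventuallyEq {y : LeftQuotient Γ} {g : G}
    (hg : proj Γ g ∈ (localSection E Γ y).source) :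
    extChartAt 𝓘(ℝ, E) y ∘ proj Γ =ᶠ[𝓝 g] extChartAt 𝓘(ℝ, E) (representative Γ y) ∘
      fun h => localSection E Γ y (proj Γ g) * g⁻¹ * h := by
  filter_upwards [localSection_proj_eventuallyEq Γ hg] with h hh
  rw [extChartAt_leftQuotient]
  exact congrArg _ hh

theorem contMDiffAt_extChartAt_proj {y : LeftQuotient Γ} {g : G}
    (hg : proj Γ g ∈ (chartAt E y).source) :
    ContMDiffAt 𝓘(ℝ, E) 𝓘(ℝ, E) ∞ (extChartAt 𝓘(ℝ, E) y ∘ proj Γ) g := by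
  rw [chartAt_leftQuotient, OpenPartialHomeomorph.trans_source] at hg
  refine ContMDiffAt.congr_of_eventuallyEq ?_ (extChartAt_proj_eventuallyEq Γ hg.1)
  refine ContMDiffAt.comp g (contMDiffAt_extChartAt' ?_) contMDiff_mul_left.contMDiffAt
  simpa using hg.2

/-- A coordinate change is an inverse chart of G, then the projection, then a chart of the quotient.
The last two together are locally a left translation followed by a chart of G. -/
instance isManifold_leftQuotient : IsManifold 𝓘(ℝ, E) ∞ (LeftQuotient Γ) := by
  refine isManifold_of_contDiffOn _ _ _ fun e e' he he' z hz => ContDiffAt.contDiffWithinAt ?_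
  rw [atlas_leftQuotient] at he he'
  obtain ⟨y, rfl⟩ := he
  obtain ⟨y', rfl⟩ := he'
  have hz' : z ∈ ((chartAt E y).symm.trans (chartAt E y')).source := hz.1
  rw [OpenPartialHomeomorph.trans_source, Set.mem_inter_iff, Set.mem_preimage] at hz'
  have h1 : z ∈ (extChartAt 𝓘(ℝ, E) (representative Γ y)).target :=
    extChartAt_leftQuotient_target_subset Γ y (by
      rw [extChartAt_target]; simpa using hz'.1)
  have e : (chartAt E y).symm z = proj Γ ((extChartAt 𝓘(ℝ, E) (representative Γ y)).symm z) :=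
    congrFun (extChartAt_leftQuotient_symm Γ y) z
  have h2 := contMDiffAt_extChartAt_proj (E := E) Γ (y := y') (e ▸ hz'.2)
  have h3 := (h2.comp z (contMDiffAt_extChartAt_symm h1)).contDiffAt
  rw [Function.comp_assoc, ← extChartAt_leftQuotient_symm] at h3
  exact h3

theorem contMDiff_proj : ContMDiff 𝓘(ℝ, E) 𝓘(ℝ, E) ∞ (proj Γ) := fun _ =>
  contMDiffAt_iff_target.2 ⟨(isLocalHomeomorph_proj E Γ).continuous.continuousAt,
    contMDiffAt_extChartAt_proj Γ (mem_chart_source E _)⟩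

/-- The chart at the orbit of g is centred at its representative r, and there the projection reads h
↦ r g⁻¹ h. -/
theorem mfderiv_proj (g : G) : (mfderiv 𝓘(ℝ, E) 𝓘(ℝ, E) (proj Γ) g : E →L[ℝ] E) =
    leftDifferential (E := E) (representative Γ (proj Γ g) * g⁻¹) g := by
  have hg := extChartAt_proj_eventuallyEq (E := E) Γ (mem_localSection_source Γ (proj Γ g))
  rw [localSection_self] at hg
  set r := representative Γ (proj Γ g) with hr
  have hr' : r * g⁻¹ * g = r := inv_mul_cancel_right r g
  have h1 : mfderiv 𝓘(ℝ, E) 𝓘(ℝ, E) (extChartAt 𝓘(ℝ, E) (proj Γ g) ∘ proj Γ) g =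
      mfderiv 𝓘(ℝ, E) 𝓘(ℝ, E) (extChartAt 𝓘(ℝ, E) r ∘ fun h => r * g⁻¹ * h) g :=
    hg.mfderiv_eq
  have h2 : mfderiv 𝓘(ℝ, E) 𝓘(ℝ, E) (extChartAt 𝓘(ℝ, E) (proj Γ g) ∘ proj Γ) g =
      (mfderiv 𝓘(ℝ, E) 𝓘(ℝ, E) (extChartAt 𝓘(ℝ, E) (proj Γ g)) (proj Γ g)).comp
        (mfderiv 𝓘(ℝ, E) 𝓘(ℝ, E) (proj Γ) g) :=
    mfderiv_comp g ((contMDiffAt_extChartAt (n := ∞)).mdifferentiableAt (by simp))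
      ((contMDiff_proj Γ).contMDiffAt.mdifferentiableAt (by simp))
  have hφ : MDifferentiableAt 𝓘(ℝ, E) 𝓘(ℝ, E) (extChartAt 𝓘(ℝ, E) r) (r * g⁻¹ * g) := by
    rw [hr']
    exact (contMDiffAt_extChartAt (n := ∞)).mdifferentiableAt (by simp)
  have h3 : mfderiv 𝓘(ℝ, E) 𝓘(ℝ, E) (extChartAt 𝓘(ℝ, E) r ∘ fun h => r * g⁻¹ * h) g =
      (mfderiv 𝓘(ℝ, E) 𝓘(ℝ, E) (extChartAt 𝓘(ℝ, E) r) (r * g⁻¹ * g)).comp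
        (leftDifferential (E := E) (r * g⁻¹) g) :=
    mfderiv_comp g hφ (mdifferentiableAt_mul_left _ g)
  rw [mfderiv_extChartAt_of_eq rfl] at h2
  rw [mfderiv_extChartAt_of_eq hr'] at h3
  exact h2.symm.trans (h1.trans h3)

end QuotientManifold

/-! ### Left-invariant tensors on the quotient -/

section InducedForms

variable {E : Type*} [NormedAddCommGroup E] [NormedSpace ℝ E]
  {G : Type*} [TopologicalSpace G] [ChartedSpace E G] [Group G] [LieGroup 𝓘(ℝ, E) ∞ G]

theorem leftDifferential_inverse_apply (g h : G) (v : E) :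
    leftDifferential g h ((leftDifferential (E := E) g h).inverse v) = v := by
  have e1 (w : E) := leftDifferential_comp_apply g g⁻¹ (g * h) w
  have e2 (w : E) := leftDifferential_comp_apply g⁻¹ g h w
  simp only [inv_mul_cancel, mul_inv_cancel, inv_mul_cancel_left, leftDifferential_one] at e1 e2
  have hinv : (leftDifferential (E := E) g h).IsInvertible :=
    ⟨ContinuousLinearEquiv.equivOfInverse _ _ e2 e1, rfl⟩
  exact hinv.self_apply_inverse v

variable [FiniteDimensional ℝ E] [T2Space G] (Γ : Subgroup G) [DiscreteTopology Γ]

/-- Left-invariance of J reconciles `Quotient.out` with the representative that defines the chart.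
-/
theorem inducedStructure_apply {J : G → E →L[ℝ] E} (hJ : IsLeftInvariantEnd (E := E) J)
    (y : LeftQuotient Γ) (v : E) :
    inducedStructure (E := E) Γ J y v = J (representative Γ y) v := by
  let g : G := Quotient.out y
  have hg : proj Γ g = y := Quotient.out_eq y
  let D : E →L[ℝ] E := leftDifferential (representative Γ y * g⁻¹) g
  have hD : (mfderiv 𝓘(ℝ, E) 𝓘(ℝ, E) (proj Γ) g : E →L[ℝ] E) = D := by
    rw [mfderiv_proj, hg]
  have h1 : inducedStructure (E := E) Γ J y v = D (J g (D.inverse v)) := by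
    rw [← hD]
    rfl
  have h2 : J (representative Γ y * g⁻¹ * g) (D (D.inverse v)) = D (J g (D.inverse v)) :=
    hJ _ _ _
  rw [inv_mul_cancel_right] at h2
  rw [h1, ← h2]
  exact congrArg (J (representative Γ y)) (leftDifferential_inverse_apply _ _ v)

/-- The form on the quotient induced by a left-invariant form. -/
def inducedForm {n : ℕ} (η : G → E [⋀^Fin n]→L[ℝ] ℂ) (y : LeftQuotient Γ) :
    E [⋀^Fin n]→L[ℝ] ℂ :=
  η (representative Γ y)

/-- The derivative of the projection is that of a left translation, which a left-invariant form
absorbs. Smoothness and the exterior derivative thus carry over from G. -/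
theorem inducedForm_inChart {n : ℕ} {η : G → E [⋀^Fin n]→L[ℝ] ℂ}
    (hη : DForm.IsLeftInvariant (E := E) η) (y : LeftQuotient Γ) {z : E}
    (hz : z ∈ (extChartAt 𝓘(ℝ, E) y).target) :
    DForm.inChart (E := E) (inducedForm Γ η) y z =
      DForm.inChart (E := E) η (representative Γ y) z := by
  have hz' := extChartAt_leftQuotient_target_subset Γ y hz
  set ψ := (extChartAt 𝓘(ℝ, E) (representative Γ y)).symm with hψ
  let D : E →L[ℝ] E := mfderiv 𝓘(ℝ, E) 𝓘(ℝ, E) ψ z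
  let r : G := representative Γ (proj Γ (ψ z))
  have h1 : (mfderiv 𝓘(ℝ, E) 𝓘(ℝ, E) (extChartAt 𝓘(ℝ, E) y).symm z : E →L[ℝ] E) =
      (leftDifferential (r * (ψ z)⁻¹) (ψ z)).comp D := by
    rw [extChartAt_leftQuotient_symm]
    refine Eq.trans ?_ (congrArg (fun A : E →L[ℝ] E => A.comp D) (mfderiv_proj Γ (ψ z)))
    exact mfderiv_comp z ((contMDiff_proj Γ).contMDiffAt.mdifferentiableAt (by simp))
      ((contMDiffAt_extChartAt_symm hz').mdifferentiableAt (by simp))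
  have h2 : (extChartAt 𝓘(ℝ, E) y).symm z = proj Γ (ψ z) :=
    congrFun (extChartAt_leftQuotient_symm Γ y) z
  have h3 : (η (r * (ψ z)⁻¹ * ψ z)).compContinuousLinearMap
      (leftDifferential (r * (ψ z)⁻¹) (ψ z)) = η (ψ z) := hη (r * (ψ z)⁻¹) (ψ z)
  rw [inv_mul_cancel_right] at h3
  have h4 : DForm.inChart (E := E) (inducedForm Γ η) y z =
      (η (representative Γ ((extChartAt 𝓘(ℝ, E) y).symm z))).compContinuousLinearMap
        (mfderiv 𝓘(ℝ, E) 𝓘(ℝ, E) (extChartAt 𝓘(ℝ, E) y).symm z : E →L[ℝ] E) := rfl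
  rw [h4, h1, h2]
  change _ = (η (ψ z)).compContinuousLinearMap D
  rw [← h3]
  rfl

theorem inducedForm_isSmoothOn {n : ℕ} {η : G → E [⋀^Fin n]→L[ℝ] ℂ}
    (hη : DForm.IsLeftInvariant (E := E) η) (hs : DForm.IsSmoothOn (E := E) η Set.univ) :
    DForm.IsSmoothOn (E := E) (inducedForm Γ η) Set.univ := by
  intro y
  refine ((hs (representative Γ y)).mono ?_).congr fun z hz => inducedForm_inChart Γ hη y hz.1
  exact Set.inter_subset_inter_left _ (extChartAt_leftQuotient_target_subset Γ y)

theorem inducedForm_d {n : ℕ} {η : G → E [⋀^Fin n]→L[ℝ] ℂ}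
    (hη : DForm.IsLeftInvariant (E := E) η) (y : LeftQuotient Γ) :
    DForm.d (E := E) (inducedForm Γ η) y = DForm.d (E := E) η (representative Γ y) := by
  refine ContinuousAlternatingMap.ext fun v => (DForm.d_apply (E := E) _ y v).trans
    (Eq.trans ?_ (DForm.d_apply (E := E) η (representative Γ y) v).symm)
  have h : DForm.inChart (E := E) (inducedForm Γ η) y =ᶠ[𝓝 (extChartAt 𝓘(ℝ, E) y y)]
      DForm.inChart (E := E) η (representative Γ y) :=
    Filter.eventuallyEq_of_mem (extChartAt_target_mem_nhds y)
      fun z hz => inducedForm_inChart Γ hη y hz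
  rw [h.extDeriv_eq, extChartAt_leftQuotient_self]

end InducedForms

/-! ### The canonical bundle of the nilmanifold -/

section Nilmanifold

variable {E : Type*} [NormedAddCommGroup E] [NormedSpace ℝ E] [FiniteDimensional ℝ E]
  {G : Type*} [TopologicalSpace G] [ChartedSpace E G] [Group G] [LieGroup 𝓘(ℝ, E) ∞ G]
  [T2Space G] (Γ : Subgroup G) [DiscreteTopology Γ]

/-- A closed left-invariant nonzero form of type `(n, 0)` trivialises the canonical bundle of
`Γ \ G`. -/
theorem canonicalBundle_leftQuotient_trivial {n : ℕ} (hn : Module.finrank ℝ E = 2 * n)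
    {J : G → E →L[ℝ] E} (hJ : ∀ x v, J x (J x v) = -v) (hJinv : IsLeftInvariantEnd (E := E) J)
    {η : G → E [⋀^Fin n]→L[ℝ] ℂ} (hη : DForm.IsLeftInvariant (E := E) η) (hη0 : ∀ x, η x ≠ 0)
    (hhol : DForm.IsHolomorphicOn (E := E) J η Set.univ) (hd : ∀ x, DForm.d (E := E) η x = 0) :
    CanonicalBundleHolomorphicallyTrivial (inducedStructure (E := E) Γ J) n := by
  have hJ' (y : LeftQuotient Γ) (v : E) := inducedStructure_apply Γ hJinv y v
  refine canonicalBundle_trivial_of_closed (E := E) (η := inducedForm Γ η) hn (fun y v => ?_)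
    (inducedForm_isSmoothOn Γ hη hhol.smooth) (fun y => hη0 _) (fun y v i => ?_) fun y => ?_
  · exact (hJ' y _).trans ((congrArg (J (representative Γ y)) (hJ' y v)).trans (hJ _ v))
  · refine Eq.trans (congrArg (fun w => η (representative Γ y) (Function.update v i w))
      (hJ' y (v i))) ?_
    exact hhol.type (representative Γ y) (Set.mem_univ _) v i
  · exact (inducedForm_d Γ hη y).trans (hd _)

end Nilmanifold

end ComplexNilmanifold

end

/-! ### The main theorem -/

open ComplexNilmanifold in
theorem mainTheorem1
    {E : Type*} [NormedAddCommGroup E] [NormedSpace ℝ E] [FiniteDimensional ℝ E]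
    {G : Type*} [TopologicalSpace G] [ChartedSpace E G] [Group G] [LieGroup 𝓘(ℝ, E) ∞ G]
    [T2Space G] [SimplyConnectedSpace G] [Group.IsNilpotent G]
    (n : ℕ) (hn : Module.finrank ℝ E = 2 * n)
    (J : EndField E G) (hJ : IsComplexStructure J) (hJinv : IsLeftInvariantEnd J)
    (Γ : Subgroup G) [DiscreteTopology Γ] [CompactSpace (LeftQuotient Γ)] :
    (∃ η : DForm E G n, η.IsLeftInvariant ∧ (∀ x, η x ≠ 0) ∧ η.IsHolomorphicOn J Set.univ) ∧
    (∃ θ : Fin n → OneForm E G, IsSalamonBasis J θ) ∧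
    (∀ θ : Fin n → OneForm E G, IsSalamonBasis J θ →
      ∀ η : DForm E G n, (η = fun x => wedge (fun i => θ i x)) →
        η.IsLeftInvariant ∧ (∀ x, η x ≠ 0) ∧ η.IsHolomorphicOn J Set.univ ∧ ∀ x, η.d x = 0) ∧
    CanonicalBundleHolomorphicallyTrivial (inducedStructure Γ J) n := by
  obtain ⟨θ, hθ⟩ := exists_isSalamonBasis hn hJ hJinv
  refine ⟨⟨_, hθ.wedge_isLeftInvariant, hθ.wedge_ne_zero, hθ.wedge_isHolomorphicOn⟩, ⟨θ, hθ⟩,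
    ?_, canonicalBundle_leftQuotient_trivial Γ hn hJ.sq hJinv hθ.wedge_isLeftInvariant
      hθ.wedge_ne_zero hθ.wedge_isHolomorphicOn hθ.wedge_d⟩
  rintro θ hθ η rfl
  exact ⟨hθ.wedge_isLeftInvariant, hθ.wedge_ne_zero, hθ.wedge_isHolomorphicOn, hθ.wedge_d⟩
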